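/- Let $f\in C^\infty(\mathbb R^2,\mathbb R)$ and let $(\delta_\varepsilon)_{\varepsilon\in(0,1]}$ represent a strict delta function on $\mathbb R$, i.e. it is a moderate net of test functions with $\operatorname{supp}\delta_\varepsilon\subseteq[-\varepsilon,\varepsilon]$, $\int\delta_\varepsilon\to1$ as $\varepsilon\to0$, and $\int|\delta_\varepsilon|\le C$ for some $C>0$ and all small $\varepsilon$. Let the smooth functions $x_\varepsilon=(x_\varepsilon^1,x_\varepsilon^2):\mathbb R^3\to\mathbb R^2$, $(X^1,X^2,U)\mapsto x_\varepsilon(X,U)$, and $v_\varepsilon:\mathbb R^4\to\mathbb R$, $(X^1,X^2,V,U)\mapsto v_\varepsilon(X,V,U)$ ($\varepsilon\in(0,1]$) form an asymptotic solution of the regularized geodesic equations with vanishing initial velocities; that is, for every compact $K\subset\mathbb R^2\times\mathbb R$ there is $\varepsilon_K\in(0,1]$ such that for all $(X,V)\in K$ and $\varepsilon\le\varepsilon_K$ the functions $x^i=x^i_\varepsilon(X,\cdot)$ and $v=v_\varepsilon(X,V,\cdot)$ satisfy on all of $\mathbb R$ $$\ddot x^i=\tfrac12\,\partial_if(x^1,x^2)\,\delta_\varepsilon\quad(i=1,2),\qquad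 \ddot v=f(x^1,x^2)\,\dot\delta_\varepsilon+2\sum_{i=1}^2\partial_if(x^1,x^2)\,\dot x^i\,\delta_\varepsilon,$$ $$x^i(-1)=X^i,\quad \dot x^i(-1)=0,\quad v(-1)=V,\quad \dot v(-1)=0 .$$ Put $t_\varepsilon(U,X^1,X^2,V):=\big(U,\,x_\varepsilon^1(X,U),\,x_\varepsilon^2(X,U),\,v_\varepsilon(X,V,U)\big)$. For open $W\subseteq\mathbb R^n$, a net $(u_\varepsilon)_\varepsilon$ in $C^\infty(W,\mathbb R)$ is moderate, resp. negligible, if for all compact $K\subset W$ and all $\alpha\in\mathbb N_0^n$ one has $\sup_K|\partial^\alpha u_\varepsilon|=O(\varepsilon^{-N})$ for some $N\in\mathbb N$, resp. $O(\varepsilon^{m})$ for all $m\in\mathbb N$; $\mathcal G(W)$ is the quotient of the moderate nets by the negligible ones. For open $W'\subseteq\mathbb R^m$, a net $(w_\varepsilon)_\varepsilon$ in $C^\infty(W,W')$ is c-bounded from $W$ into $W'$ if all its components are moderate and for every compact $K\subset W$ there are a compact $L\subset W'$ and $\varepsilon_0\in(0,1]$ with $w_\varepsilon(K)\subseteq L$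 for all $\varepsilon\le\varepsilon_0$; $\mathcal G[W,W']\subseteq\mathcal G(W)^m$ is the set of classes that have a c-bounded representative. Then $(t_\varepsilon)_\varepsilon$ is c-bounded from $\mathbb R^4$ into $\mathbb R^4$; in particular, its components are moderate and the generalized coordinate transformation $T=[(t_\varepsilon)_\varepsilon]$ is an element of $\mathcal G[\mathbb R^4,\mathbb R^4]$. Furthermore, for all $\alpha\in\mathbb N_0^2$ and $i=1,2$, the nets $(\partial_X^\alpha x_\varepsilon^i)_\varepsilon$ and $(\partial_X^\alpha\partial_Ux_\varepsilon^i)_\varepsilon$ are c-bounded from $\mathbb R^3$ into $\mathbb R$. -/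

import Mathlib

open scoped ContDiff
open Filter Topology MeasureTheory TopologicalSpace

namespace PPWave

/-- The index set `(0,1]` of all nets. -/
abbrev Eps : Type := Set.Ioc (0 : ℝ) 1

/-- The classical partial derivative `∂_j u` of a real valued function on `ℝⁿ`. -/
noncomputable def partialDeriv {n : ℕ} (j : Fin n) (u : (Fin n → ℝ) → ℝ) : (Fin n → ℝ) → ℝ :=
  fun y => fderiv ℝ u y (Pi.single j 1)

/-- `∂^α u = ∂_1^{α_1} ⋯ ∂_n^{α_n} u` for a multi-index `α` (the innermost operator is applied
first). -/
noncomputable def multiDeriv {n : ℕ} (α : Fin n → ℕ) (u : (Fin n → ℝ) → ℝ) : (Fin n → ℝ) → ℝ :=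
  (List.finRange n).foldr (fun j w => (partialDeriv j)^[α j] w) u

/-- `sup_{y ∈ K} |∂^α u_ε(y)| = O(ε^p)` as `ε → 0`. -/
def DerivBound {n : ℕ} (u : Eps → (Fin n → ℝ) → ℝ) (K : Set (Fin n → ℝ)) (α : Fin n → ℕ)
    (p : ℤ) : Prop :=
  ∃ C : ℝ, ∃ ε₀ : Eps, ∀ ε : Eps, ε ≤ ε₀ → ∀ y ∈ K, |multiDeriv α (u ε) y| ≤ C * (ε : ℝ) ^ p

/-! ### Linearity of the derivatives, needed for the quotient below -/

theorem partialDeriv_lincomb {n : ℕ} (U : Opens (Fin n → ℝ)) (j : Fin n) (a b : ℝ)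
    {u w s : (Fin n → ℝ) → ℝ}
    (h : ContDiffOn ℝ ∞ u U ∧ ContDiffOn ℝ ∞ w U ∧ ∀ y ∈ U, s y = a * u y + b * w y) :
    ContDiffOn ℝ ∞ (partialDeriv j u) U ∧ ContDiffOn ℝ ∞ (partialDeriv j w) U ∧
      ∀ y ∈ U, partialDeriv j s y = a * partialDeriv j u y + b * partialDeriv j w y := by
  obtain ⟨hu, hw, hs⟩ := h
  refine ⟨(hu.fderiv_of_isOpen U.isOpen (by simp)).clm_apply contDiffOn_const,
    (hw.fderiv_of_isOpen U.isOpen (by simp)).clm_apply contDiffOn_const, fun y hy => ?_⟩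
  have hU : (U : Set (Fin n → ℝ)) ∈ 𝓝 y := U.isOpen.mem_nhds hy
  have du : DifferentiableAt ℝ u y := (hu.contDiffAt hU).differentiableAt (by simp)
  have dw : DifferentiableAt ℝ w y := (hw.contDiffAt hU).differentiableAt (by simp)
  have he : s =ᶠ[𝓝 y] fun z => a * u z + b * w z := by
    filter_upwards [hU] with z hz using hs z hz
  have hd : HasFDerivAt (fun z => a * u z + b * w z) (a • fderiv ℝ u y + b • fderiv ℝ w y) y :=
    (du.hasFDerivAt.const_mul a).add (dw.hasFDerivAt.const_mul b)
  simp [partialDeriv, he.fderiv_eq, hd.fderiv]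

theorem multiDeriv_lincomb {n : ℕ} (U : Opens (Fin n → ℝ)) (α : Fin n → ℕ) (a b : ℝ)
    {u w s : (Fin n → ℝ) → ℝ}
    (h : ContDiffOn ℝ ∞ u U ∧ ContDiffOn ℝ ∞ w U ∧ ∀ y ∈ U, s y = a * u y + b * w y) :
    ContDiffOn ℝ ∞ (multiDeriv α u) U ∧ ContDiffOn ℝ ∞ (multiDeriv α w) U ∧
      ∀ y ∈ U, multiDeriv α s y = a * multiDeriv α u y + b * multiDeriv α w y := by
  unfold multiDeriv
  induction List.finRange n with
  | nil => exact h
  | cons j l ih =>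
    simp only [List.foldr_cons]
    induction α j with
    | zero => exact ih
    | succ k ihk =>
      simp only [Function.iterate_succ_apply']
      exact partialDeriv_lincomb U j a b ihk

theorem DerivBound.lincomb {n : ℕ} {U : Opens (Fin n → ℝ)} {u w : Eps → (Fin n → ℝ) → ℝ}
    {K : Set (Fin n → ℝ)} (hK : K ⊆ U) {α : Fin n → ℕ} {p q r : ℤ} (hp : r ≤ p) (hq : r ≤ q)
    (hu : ∀ ε, ContDiffOn ℝ ∞ (u ε) U) (hw : ∀ ε, ContDiffOn ℝ ∞ (w ε) U) (a b : ℝ)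
    (bu : DerivBound u K α p) (bw : DerivBound w K α q) :
    DerivBound (a • u + b • w) K α r := by
  obtain ⟨C, e, hC⟩ := bu
  obtain ⟨D, e', hD⟩ := bw
  refine ⟨|a| * |C| + |b| * |D|, min e e', fun ε hε y hy => ?_⟩
  have h1 := hC ε (hε.trans (min_le_left _ _)) y hy
  have h2 := hD ε (hε.trans (min_le_right _ _)) y hy
  have h3 := (multiDeriv_lincomb U α a b (s := (a • u + b • w) ε)
    ⟨hu ε, hw ε, fun z _ => by simp⟩).2.2 y (hK hy)
  have hpos : (0 : ℝ) < ε := ε.2.1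
  have h4 : (ε : ℝ) ^ p ≤ (ε : ℝ) ^ r := zpow_le_zpow_right_of_le_one₀ hpos ε.2.2 hp
  have h5 : (ε : ℝ) ^ q ≤ (ε : ℝ) ^ r := zpow_le_zpow_right_of_le_one₀ hpos ε.2.2 hq
  have h6 : |multiDeriv α (u ε) y| ≤ |C| * (ε : ℝ) ^ r :=
    h1.trans ((mul_le_mul_of_nonneg_right (le_abs_self C) (zpow_pos hpos p).le).trans
      (mul_le_mul_of_nonneg_left h4 (abs_nonneg C)))
  have h7 : |multiDeriv α (w ε) y| ≤ |D| * (ε : ℝ) ^ r :=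
    h2.trans ((mul_le_mul_of_nonneg_right (le_abs_self D) (zpow_pos hpos q).le).trans
      (mul_le_mul_of_nonneg_left h5 (abs_nonneg D)))
  rw [h3]
  calc |a * multiDeriv α (u ε) y + b * multiDeriv α (w ε) y|
      ≤ |a| * |multiDeriv α (u ε) y| + |b| * |multiDeriv α (w ε) y| := by
        simpa [abs_mul] using
          abs_add_le (a * multiDeriv α (u ε) y) (b * multiDeriv α (w ε) y)
    _ ≤ |a| * (|C| * (ε : ℝ) ^ r) + |b| * (|D| * (ε : ℝ) ^ r) := by gcongr
    _ = _ := by ring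

theorem derivBound_zero {n : ℕ} (K : Set (Fin n → ℝ)) (α : Fin n → ℕ) (p : ℤ) :
    DerivBound (0 : Eps → (Fin n → ℝ) → ℝ) K α p := by
  refine ⟨0, ⟨1, by norm_num, le_rfl⟩, fun ε _ y _ => ?_⟩
  have h := (multiDeriv_lincomb (⊤ : Opens (Fin n → ℝ)) α 0 0
    (u := fun _ => 0) (w := fun _ => 0) (s := (0 : Eps → (Fin n → ℝ) → ℝ) ε)
    ⟨contDiffOn_const, contDiffOn_const, fun z _ => by simp⟩).2.2 y trivial
  rw [h]
  simp

/-! ### Colombeau generalized functions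

A net on an open set `U ⊆ ℝⁿ` is represented by functions on `ℝⁿ`; only their restrictions to `U`
matter, and two nets that agree on `U` differ by a negligible one. -/

/-- The moderate nets `ℰ_M(U)`. -/
def moderate {n : ℕ} (U : Opens (Fin n → ℝ)) : Submodule ℝ (Eps → (Fin n → ℝ) → ℝ) where
  carrier := {u | (∀ ε, ContDiffOn ℝ ∞ (u ε) U) ∧
    ∀ K : Set (Fin n → ℝ), IsCompact K → K ⊆ U → ∀ α : Fin n → ℕ, ∃ N : ℕ,
      DerivBound u K α (-(N : ℤ))}
  zero_mem' := ⟨fun _ => contDiffOn_const, fun K _ _ α => ⟨0, derivBound_zero K α _⟩⟩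
  add_mem' := by
    rintro u w ⟨hu, bu⟩ ⟨hw, bw⟩
    refine ⟨fun ε => (hu ε).add (hw ε), fun K hK hKU α => ?_⟩
    obtain ⟨N, hN⟩ := bu K hK hKU α
    obtain ⟨M, hM⟩ := bw K hK hKU α
    refine ⟨max N M, ?_⟩
    simpa using DerivBound.lincomb (r := -((max N M : ℕ) : ℤ)) hKU (by omega) (by omega)
      hu hw 1 1 hN hM
  smul_mem' := by
    rintro a u ⟨hu, bu⟩
    refine ⟨fun ε => (hu ε).const_smul a, fun K hK hKU α => ?_⟩
    obtain ⟨N, hN⟩ := bu K hK hKU α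
    exact ⟨N, by simpa using DerivBound.lincomb hKU le_rfl le_rfl hu hu a 0 hN hN⟩

/-- The negligible nets `𝒩(U)`. -/
def negligible {n : ℕ} (U : Opens (Fin n → ℝ)) : Submodule ℝ (Eps → (Fin n → ℝ) → ℝ) where
  carrier := {u | (∀ ε, ContDiffOn ℝ ∞ (u ε) U) ∧
    ∀ K : Set (Fin n → ℝ), IsCompact K → K ⊆ U → ∀ α : Fin n → ℕ, ∀ m : ℕ,
      DerivBound u K α (m : ℤ)}
  zero_mem' := ⟨fun _ => contDiffOn_const, fun K _ _ α m => derivBound_zero K α _⟩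
  add_mem' := by
    rintro u w ⟨hu, bu⟩ ⟨hw, bw⟩
    refine ⟨fun ε => (hu ε).add (hw ε), fun K hK hKU α m => ?_⟩
    simpa using DerivBound.lincomb hKU le_rfl le_rfl hu hw 1 1
      (bu K hK hKU α m) (bw K hK hKU α m)
  smul_mem' := by
    rintro a u ⟨hu, bu⟩
    refine ⟨fun ε => (hu ε).const_smul a, fun K hK hKU α m => ?_⟩
    simpa using DerivBound.lincomb hKU le_rfl le_rfl hu hu a 0 (bu K hK hKU α m)
      (bu K hK hKU α m)

/-- The Colombeau space `𝒢(U) = ℰ_M(U) / 𝒩(U)` (only its linear structure is used). -/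
abbrev ColombeauSpace {n : ℕ} (U : Opens (Fin n → ℝ)) : Type :=
  moderate U ⧸ (negligible U).submoduleOf (moderate U)

/-- The generalized function `[(w_ε)_ε] ∈ 𝒢(U)^m` of a net with moderate components. -/
def genClass {n m : ℕ} (U : Opens (Fin n → ℝ)) (w : Eps → (Fin n → ℝ) → (Fin m → ℝ))
    (h : ∀ j : Fin m, (fun ε y => w ε y j) ∈ moderate U) : Fin m → ColombeauSpace U :=
  fun j => Submodule.Quotient.mk ⟨fun ε y => w ε y j, h j⟩

/-- The set `ℰ_M[U,V]` of c-bounded nets from `U` into `V`. -/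
def cBoundedNets {n m : ℕ} (U : Opens (Fin n → ℝ)) (V : Opens (Fin m → ℝ)) :
    Set (Eps → (Fin n → ℝ) → (Fin m → ℝ)) :=
  {w | (∀ ε, ContDiffOn ℝ ∞ (w ε) U ∧ Set.MapsTo (w ε) U V) ∧
    (∀ K : Set (Fin n → ℝ), IsCompact K → K ⊆ U →
      ∃ L : Set (Fin m → ℝ), IsCompact L ∧ L ⊆ V ∧
        ∃ ε₀ : Eps, ∀ ε : Eps, ε ≤ ε₀ → Set.MapsTo (w ε) K L) ∧
    (∀ K : Set (Fin n → ℝ), IsCompact K → K ⊆ U → ∀ α : Fin n → ℕ, ∃ N : ℕ,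
      ∀ j : Fin m, DerivBound (fun ε y => w ε y j) K α (-(N : ℤ)))}

/-- The set `𝒢[U,V] ⊆ 𝒢(U)^m` of c-bounded generalized functions from `U` into `V`: those which
have a c-bounded representative. -/
def cBoundedGen {n m : ℕ} (U : Opens (Fin n → ℝ)) (V : Opens (Fin m → ℝ)) :
    Set (Fin m → ColombeauSpace U) :=
  {T | ∃ w ∈ cBoundedNets U V, ∃ h : ∀ j : Fin m, (fun ε y => w ε y j) ∈ moderate U,
    T = genClass U w h}

/-! ### Regularized geodesics and the generalized coordinate transformation -/

/-- `(δ_ε)_ε` is a strict delta net on `ℝ` which is moderate, so that `[(δ_ε)_ε] ∈ 𝒢(ℝ)` is a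
strict delta function. -/
structure IsStrictDelta (δ : Eps → ℝ → ℝ) : Prop where
  smooth : ∀ ε, ContDiff ℝ ∞ (δ ε)
  supp : ∀ ε : Eps, tsupport (δ ε) ⊆ Set.Icc (-(ε : ℝ)) (ε : ℝ)
  integral_tendsto :
    Tendsto (fun ε : Eps => ∫ r, δ ε r) (comap (fun ε : Eps => (ε : ℝ)) (𝓝 0)) (𝓝 1)
  integral_abs_le : ∃ C : ℝ, 0 < C ∧ ∃ ε₀ : Eps, ∀ ε : Eps, ε ≤ ε₀ → ∫ r, |δ ε r| ≤ C
  moderate : (fun ε (y : Fin 1 → ℝ) => δ ε (y 0)) ∈ moderate (⊤ : Opens (Fin 1 → ℝ))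

/-- The pair of curves `c = (x¹, x²)`, `v` is a solution on all of `ℝ` of the regularized geodesic
equations with profile `f` and regularized delta `d`, with initial positions `X`, `V` and vanishing
initial velocities at `u = -1`. -/
structure IsGeodesic (f : (Fin 2 → ℝ) → ℝ) (d : ℝ → ℝ) (X : Fin 2 → ℝ) (V : ℝ)
    (c : ℝ → Fin 2 → ℝ) (v : ℝ → ℝ) : Prop where
  eq_x : ∀ (i : Fin 2) (u : ℝ),
    deriv (deriv fun r => c r i) u = 1 / 2 * partialDeriv i f (c u) * d u
  eq_v : ∀ u : ℝ, deriv (deriv v) u = f (c u) * deriv d u +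
    2 * ∑ i : Fin 2, partialDeriv i f (c u) * deriv (fun r => c r i) u * d u
  init_x : c (-1) = X
  init_x' : ∀ i : Fin 2, deriv (fun r => c r i) (-1) = 0
  init_v : v (-1) = V
  init_v' : deriv v (-1) = 0

/-- Nets of smooth functions `x_ε(X¹,X²,U)` and `v_ε(X¹,X²,V,U)` which form an asymptotic solution
of the regularized geodesic equations with vanishing initial velocities: for initial positions in
a compact set and all sufficiently small `ε`, they are the global solution. -/
structure IsAsymptoticSolution (f : (Fin 2 → ℝ) → ℝ) (δ : Eps → ℝ → ℝ)
    (x : Eps → (Fin 3 → ℝ) → (Fin 2 → ℝ)) (v : Eps → (Fin 4 → ℝ) → ℝ) : Prop where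
  smooth_x : ∀ ε, ContDiff ℝ ∞ (x ε)
  smooth_v : ∀ ε, ContDiff ℝ ∞ (v ε)
  solves : ∀ K : Set ((Fin 2 → ℝ) × ℝ), IsCompact K → ∃ ε₀ : Eps, ∀ ε : Eps, ε ≤ ε₀ →
    ∀ p ∈ K, IsGeodesic f (δ ε) p.1 p.2 (fun u => x ε ![p.1 0, p.1 1, u])
      (fun u => v ε ![p.1 0, p.1 1, p.2, u])

/-- The net `t_ε(U,X¹,X²,V) = (U, x_ε¹(X,U), x_ε²(X,U), v_ε(X,V,U))`. -/
def transform (x : Eps → (Fin 3 → ℝ) → (Fin 2 → ℝ)) (v : Eps → (Fin 4 → ℝ) → ℝ) :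
    Eps → (Fin 4 → ℝ) → (Fin 4 → ℝ) :=
  fun ε y => ![y 0, x ε ![y 1, y 2, y 0] 0, x ε ![y 1, y 2, y 0] 1, v ε ![y 1, y 2, y 3, y 0]]

end PPWave

open PPWave

namespace PPWave

/-! ### Partial derivatives -/

/-! The kick `δ_ε` acts only during `[-ε, ε]`, but its absolute mass stays below some `C`. A curve
that starts at rest and obeys `ẍ = F(x) δ_ε` has speed at most `MC` as long as `|F(x)| ≤ M`, so it
moves by only `O(ε)` during the kick. A continuity argument keeps it within distance 1 of its
starting point; afterwards it is a straight line of bounded slope (`growth_of_nonlinear_system`).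

Derivatives of `x` solve linear systems `z̈ = a z δ_ε + r δ_ε + h`, where `a`, the Jacobian of `F`
along `x`, is bounded. As the kick is short, the term `a z δ_ε` changes `z` during the kick by at
most half of its maximum there and is absorbed; `z` and `ż` are then bounded linearly in the data,
uniformly in `ε` (`exists_bound_linear_pulse`). Differentiating again leaves `a` unchanged and
alters only `r` and `h`, which gives an induction on the order (`derivGrowth_of_linear_system`,
`IsAsymptoticSolution.derivGrowth_xNet`).

The admissible powers of `ε⁻¹` are collected in a submonoid `S` of `ℕ`, so one induction serves two
purposes. In the `X` directions `δ_ε` has zero derivative and `S = ⊥` gives uniform bounds; in all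
directions the derivatives of `δ_ε` are moderate and `S = ⊤` gives moderateness.

For `v`, the force equals `d/dU (f(x) δ_ε) + Σ ∂ᵢf(x) ẋⁱ δ_ε`. Hence `v̇ - f(x) δ_ε` is bounded, and
although `v̇` itself need not be, its integral is (`growth_v`). Moderateness of `v` follows from the
linear theory with `a = 0` (`derivGrowth_v`). -/

theorem partialDeriv_contDiff {n : ℕ} (j : Fin n) {u : (Fin n → ℝ) → ℝ} (hu : ContDiff ℝ ∞ u) :
    ContDiff ℝ ∞ (partialDeriv j u) :=
  (hu.fderiv_right (m := ∞) (by simp)).clm_apply contDiff_const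

theorem partialDeriv_comm {n : ℕ} (i j : Fin n) {u : (Fin n → ℝ) → ℝ} (hu : ContDiff ℝ ∞ u) :
    partialDeriv i (partialDeriv j u) = partialDeriv j (partialDeriv i u) := by
  have hd : Differentiable ℝ (fderiv ℝ u) :=
    (hu.fderiv_right (m := ∞) (by simp)).differentiable (by simp)
  have key : ∀ (i j : Fin n) (y : Fin n → ℝ), partialDeriv i (partialDeriv j u) y =
      fderiv ℝ (fderiv ℝ u) y (Pi.single i 1) (Pi.single j 1) := by
    intro i j y
    have h := (hd y).hasFDerivAt.clm_apply (hasFDerivAt_const (Pi.single j (1 : ℝ)) y)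
    change fderiv ℝ (fun z => fderiv ℝ u z (Pi.single j 1)) y (Pi.single i 1) = _
    rw [h.fderiv]
    simp
  funext y
  rw [key, key]
  exact (hu.contDiffAt.isSymmSndFDerivAt (by simpa using WithTop.coe_le_coe.2 (le_top : (2 : ℕ∞) ≤ ⊤))).eq _ _

theorem partialDeriv_comp {n m : ℕ} (j : Fin n) {f : (Fin m → ℝ) → ℝ}
    {g : (Fin n → ℝ) → Fin m → ℝ} (hf : Differentiable ℝ f) (hg : Differentiable ℝ g)
    (y : Fin n → ℝ) :
    partialDeriv j (fun z => f (g z)) y =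
      ∑ i, partialDeriv i f (g y) * partialDeriv j (fun z => g z i) y := by
  have h1 : HasFDerivAt (fun z => f (g z)) ((fderiv ℝ f (g y)).comp (fderiv ℝ g y)) y :=
    (hf (g y)).hasFDerivAt.comp y (hg y).hasFDerivAt
  have h2 : ∀ i, fderiv ℝ (fun z => g z i) y (Pi.single j 1) = fderiv ℝ g y (Pi.single j 1) i := by
    intro i
    rw [((hasFDerivAt_pi'.1 (hg y).hasFDerivAt) i).fderiv]
    rfl
  simp only [partialDeriv, h1.fderiv, h2, ContinuousLinearMap.comp_apply]
  conv_lhs => rw [pi_eq_sum_univ' (fderiv ℝ g y (Pi.single j 1)), map_sum]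
  refine Finset.sum_congr rfl fun i _ => ?_
  rw [map_smul, smul_eq_mul, mul_comm]

theorem hasDerivAt_comp_update {n : ℕ} (p : Fin n) {u : (Fin n → ℝ) → ℝ}
    (hu : Differentiable ℝ u) (y : Fin n → ℝ) (r : ℝ) :
    HasDerivAt (fun s => u (Function.update y p s))
      (partialDeriv p u (Function.update y p r)) r :=
  (hu _).hasFDerivAt.comp_hasDerivAt r (hasDerivAt_update y p r)

theorem partialDeriv_congr {n : ℕ} (j : Fin n) {u w : (Fin n → ℝ) → ℝ} {y : Fin n → ℝ}
    (h : u =ᶠ[𝓝 y] w) : partialDeriv j u y = partialDeriv j w y := by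
  simp only [partialDeriv, h.fderiv_eq]

theorem partialDeriv_coord {n : ℕ} (i j : Fin n) (y : Fin n → ℝ) :
    partialDeriv j (fun z => z i) y = if i = j then 1 else 0 := by
  have h : HasFDerivAt (fun z : Fin n → ℝ => z i) (ContinuousLinearMap.proj i) y :=
    (ContinuousLinearMap.proj (R := ℝ) (φ := fun _ : Fin n => ℝ) i).hasFDerivAt
  simp [partialDeriv, h.fderiv, Pi.single_apply]

/-! ### Nets -/

instance : Nonempty Eps := ⟨⟨1, by norm_num, le_rfl⟩⟩

/-- Nets of real valued functions on `ℝⁿ`. -/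
abbrev Net (n : ℕ) : Type := Eps → (Fin n → ℝ) → ℝ

/-- The members of the net are smooth. -/
def Net.Smooth {n : ℕ} (u : Net n) : Prop := ∀ ε, ContDiff ℝ ∞ (u ε)

/-- The net of partial derivatives. -/
noncomputable def pd {n : ℕ} (j : Fin n) (u : Net n) : Net n := fun ε => partialDeriv j (u ε)

theorem Net.Smooth.pd {n : ℕ} {u : Net n} (hu : u.Smooth) (j : Fin n) : (pd j u).Smooth :=
  fun ε => partialDeriv_contDiff j (hu ε)

theorem Net.Smooth.differentiable {n : ℕ} {u : Net n} (hu : u.Smooth) (ε : Eps) :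
    Differentiable ℝ (u ε) := (hu ε).differentiable (by simp)

theorem Net.Smooth.add {n : ℕ} {u w : Net n} (hu : u.Smooth) (hw : w.Smooth) : (u + w).Smooth :=
  fun ε => (hu ε).add (hw ε)

theorem Net.Smooth.mul {n : ℕ} {u w : Net n} (hu : u.Smooth) (hw : w.Smooth) : (u * w).Smooth :=
  fun ε => (hu ε).mul (hw ε)

/-- The net all of whose members are the constant function `c`. -/
def constNet (n : ℕ) (c : ℝ) : Net n := fun _ _ => c

theorem smooth_constNet {n : ℕ} (c : ℝ) : (constNet n c).Smooth := fun _ => contDiff_const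

theorem Net.Smooth.sum {n : ℕ} {ι : Type*} {s : Finset ι} {u : ι → Net n}
    (hu : ∀ i ∈ s, (u i).Smooth) : (∑ i ∈ s, u i).Smooth := by
  intro ε
  rw [Finset.sum_apply]
  have : (∑ i ∈ s, u i ε) = fun y => ∑ i ∈ s, u i ε y := by funext y; simp
  rw [this]
  exact ContDiff.sum fun i hi => hu i hi ε

theorem pd_add {n : ℕ} (j : Fin n) {u w : Net n} (hu : u.Smooth) (hw : w.Smooth) :
    pd j (u + w) = pd j u + pd j w := by
  funext ε y
  simp [pd, partialDeriv, fderiv_add (hu.differentiable ε y) (hw.differentiable ε y)]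

theorem pd_mul {n : ℕ} (j : Fin n) {u w : Net n} (hu : u.Smooth) (hw : w.Smooth) :
    pd j (u * w) = pd j u * w + u * pd j w := by
  funext ε y
  simp only [pd, partialDeriv, Pi.mul_apply, Pi.add_apply,
    fderiv_mul (hu.differentiable ε y) (hw.differentiable ε y)]
  simp
  ring

theorem pd_constNet {n : ℕ} (j : Fin n) (c : ℝ) : pd j (constNet n c) = constNet n 0 := by
  funext ε y
  have : constNet n c ε = fun _ => c := rfl
  simp [pd, partialDeriv, this, constNet]

theorem constNet_zero (n : ℕ) : constNet n 0 = 0 := rfl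

theorem pd_sum {n : ℕ} {ι : Type*} (j : Fin n) (s : Finset ι) {u : ι → Net n}
    (hu : ∀ i, (u i).Smooth) : pd j (∑ i ∈ s, u i) = ∑ i ∈ s, pd j (u i) := by
  classical
  induction s using Finset.induction_on with
  | empty => simpa [constNet_zero] using pd_constNet (n := n) j 0
  | insert i s hi ih =>
    rw [Finset.sum_insert hi, Finset.sum_insert hi,
      pd_add j (hu i) (Net.Smooth.sum fun i _ => hu i), ih]

theorem pd_comm {n : ℕ} (i j : Fin n) {u : Net n} (hu : u.Smooth) :
    pd i (pd j u) = pd j (pd i u) := by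
  funext ε
  exact partialDeriv_comm i j (hu ε)

/-- Composition of a function with nets. -/
def Net.comp {n m : ℕ} (f : (Fin m → ℝ) → ℝ) (x : Fin m → Net n) : Net n :=
  fun ε y => f fun i => x i ε y

theorem smooth_comp {n m : ℕ} {f : (Fin m → ℝ) → ℝ} (hf : ContDiff ℝ ∞ f) {x : Fin m → Net n}
    (hx : ∀ i, (x i).Smooth) : (Net.comp f x).Smooth :=
  fun ε => hf.comp (contDiff_pi.2 fun i => hx i ε)

theorem pd_comp {n m : ℕ} (j : Fin n) {f : (Fin m → ℝ) → ℝ} (hf : ContDiff ℝ ∞ f)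
    {x : Fin m → Net n} (hx : ∀ i, (x i).Smooth) :
    pd j (Net.comp f x) = ∑ i, Net.comp (partialDeriv i f) x * pd j (x i) := by
  funext ε y
  simp only [Finset.sum_apply, Pi.mul_apply]
  exact partialDeriv_comp j (g := fun z i => x i ε z) (hf.differentiable (by simp))
    ((contDiff_pi.2 fun i => hx i ε).differentiable (by simp)) y

/-- Pullback of a net along a map of coordinates. -/
def Net.reindex {n m : ℕ} (σ : Fin m → Fin n) (u : Net m) : Net n := fun ε y => u ε fun i => y (σ i)

theorem Net.Smooth.reindex {n m : ℕ} {u : Net m} (hu : u.Smooth) (σ : Fin m → Fin n) :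
    (u.reindex σ).Smooth :=
  fun ε => (hu ε).comp (contDiff_pi.2 fun i => contDiff_apply ℝ ℝ (σ i))

theorem pd_reindex {n m : ℕ} (j : Fin n) (σ : Fin m → Fin n) {u : Net m} (hu : u.Smooth) :
    pd j (u.reindex σ) =
      ∑ i, constNet n (if σ i = j then 1 else 0) * (pd i u).reindex σ := by
  funext ε y
  simp only [Finset.sum_apply, Pi.mul_apply]
  have := partialDeriv_comp j (f := u ε) (g := fun z i => z (σ i)) (hu.differentiable ε)
    ((contDiff_pi.2 fun i => contDiff_apply ℝ ℝ (σ i)).differentiable (by simp : (∞ : WithTop ℕ∞) ≠ 0)) y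
  simp only [partialDeriv_coord] at this
  refine this.trans (Finset.sum_congr rfl fun i _ => mul_comm _ _)

theorem pd_reindex_of_injective {n m : ℕ} (i : Fin m) {σ : Fin m → Fin n}
    (hσ : Function.Injective σ) {u : Net m} (hu : u.Smooth) :
    pd (σ i) (u.reindex σ) = (pd i u).reindex σ := by
  rw [pd_reindex _ _ hu, Finset.sum_eq_single i]
  · funext ε y
    simp [constNet]
  · intro l _ hl
    rw [if_neg fun h => hl (hσ h), constNet_zero, zero_mul]
  · simp

/-! ### Eventual equality on balls -/

/-- On every ball and for small `ε`, the nets agree on `Ω`. -/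
def EvEqOn {n : ℕ} (Ω : Set (Fin n → ℝ)) (u w : Net n) : Prop :=
  ∀ R : ℝ, ∀ᶠ ε in atBot, ∀ y ∈ Ω, ‖y‖ ≤ R → u ε y = w ε y

theorem EvEqOn.pd {n : ℕ} {Ω : Set (Fin n → ℝ)} (hΩ : IsOpen Ω) {u w : Net n} (h : EvEqOn Ω u w)
    (j : Fin n) : EvEqOn Ω (pd j u) (pd j w) := by
  intro R
  -- A derivative at a point of the closed ball needs agreement on a neighbourhood, hence the larger
  -- radius.
  filter_upwards [h (R + 1)] with ε hε y hy hyR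
  refine partialDeriv_congr j ?_
  filter_upwards [hΩ.mem_nhds hy, (isOpen_lt continuous_norm continuous_const).mem_nhds
    (show ‖y‖ < R + 1 by linarith)] with z hz hz'
  exact hε z hz (le_of_lt hz')

theorem eventually_lt_of_pos {c : ℝ} (hc : 0 < c) : ∀ᶠ ε : Eps in atBot, (ε : ℝ) < c := by
  refine eventually_atBot.2 ⟨⟨min 1 (c / 2), by positivity, min_le_left _ _⟩, fun ε hε => ?_⟩
  have : (ε : ℝ) ≤ min 1 (c / 2) := hε
  linarith [min_le_right 1 (c / 2)]

/-! ### Growth -/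

/-- A smooth net is bounded on balls by a power of `ε⁻¹` with exponent in `S`. For `S = ⊥` this is
uniform boundedness, for `S = ⊤` it is the zeroth order moderateness estimate. -/
def Growth {n : ℕ} (S : AddSubmonoid ℕ) (u : Net n) : Prop :=
  u.Smooth ∧ ∀ R : ℝ, ∃ N ∈ S, ∃ C : ℝ, ∀ᶠ ε : Eps in atBot, ∀ y, ‖y‖ ≤ R →
    |u ε y| ≤ C * (ε : ℝ)⁻¹ ^ N

theorem one_le_inv_pow (ε : Eps) (N : ℕ) : 1 ≤ (ε : ℝ)⁻¹ ^ N :=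
  one_le_pow₀ ((one_le_inv₀ ε.2.1).2 ε.2.2)

theorem Growth.mono {n : ℕ} {S T : AddSubmonoid ℕ} (h : S ≤ T) {u : Net n} (hu : Growth S u) :
    Growth T u :=
  ⟨hu.1, fun R => let ⟨N, hN, H⟩ := hu.2 R; ⟨N, h hN, H⟩⟩

theorem growth_constNet {n : ℕ} (S : AddSubmonoid ℕ) (c : ℝ) : Growth S (constNet n c) :=
  ⟨smooth_constNet c, fun _ => ⟨0, S.zero_mem, |c|, Eventually.of_forall fun _ _ _ => by
    simp [constNet]⟩⟩

theorem le_inv_pow_of_le {ε : Eps} {a C : ℝ} {N : ℕ} (M : ℕ) (h : a ≤ C * (ε : ℝ)⁻¹ ^ N) :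
    a ≤ |C| * (ε : ℝ)⁻¹ ^ (N + M) := by
  have h1 : (ε : ℝ)⁻¹ ^ N ≤ (ε : ℝ)⁻¹ ^ (N + M) :=
    pow_le_pow_right₀ ((one_le_inv₀ ε.2.1).2 ε.2.2) (by omega)
  have h2 := one_le_inv_pow ε N
  calc a ≤ C * (ε : ℝ)⁻¹ ^ N := h
    _ ≤ |C| * (ε : ℝ)⁻¹ ^ N := by gcongr; exact le_abs_self C
    _ ≤ _ := by gcongr

theorem Growth.add {n : ℕ} {S : AddSubmonoid ℕ} {u w : Net n} (hu : Growth S u)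
    (hw : Growth S w) : Growth S (u + w) := by
  refine ⟨hu.1.add hw.1, fun R => ?_⟩
  obtain ⟨N, hN, C, hC⟩ := hu.2 R
  obtain ⟨M, hM, D, hD⟩ := hw.2 R
  refine ⟨N + M, S.add_mem hN hM, |C| + |D|, ?_⟩
  filter_upwards [hC, hD] with ε h1 h2 y hy
  have h3 := le_inv_pow_of_le M (h1 y hy)
  have h4 := le_inv_pow_of_le N (h2 y hy)
  rw [add_comm M N] at h4
  calc |(u + w) ε y| ≤ |u ε y| + |w ε y| := abs_add_le _ _
    _ ≤ _ := by rw [add_mul]; exact add_le_add h3 h4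

theorem Growth.mul {n : ℕ} {S : AddSubmonoid ℕ} {u w : Net n} (hu : Growth S u)
    (hw : Growth S w) : Growth S (u * w) := by
  refine ⟨hu.1.mul hw.1, fun R => ?_⟩
  obtain ⟨N, hN, C, hC⟩ := hu.2 R
  obtain ⟨M, hM, D, hD⟩ := hw.2 R
  refine ⟨N + M, S.add_mem hN hM, |C| * |D|, ?_⟩
  filter_upwards [hC, hD] with ε h1 h2 y hy
  have h3 := le_inv_pow_of_le 0 (h1 y hy)
  have h4 := le_inv_pow_of_le 0 (h2 y hy)
  have h5 := one_le_inv_pow ε N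
  calc |(u * w) ε y| = |u ε y| * |w ε y| := abs_mul _ _
    _ ≤ (|C| * (ε : ℝ)⁻¹ ^ (N + 0)) * (|D| * (ε : ℝ)⁻¹ ^ (M + 0)) := by gcongr
    _ = _ := by rw [pow_add]; ring

/-- Finitely many nets have a common bound. -/
theorem Growth.uniform {n : ℕ} {S : AddSubmonoid ℕ} {ι : Type*} [Fintype ι] {u : ι → Net n}
    (hu : ∀ i, Growth S (u i)) (R : ℝ) : ∃ N ∈ S, ∃ C : ℝ, 0 ≤ C ∧ ∀ᶠ ε : Eps in atBot, ∀ i y,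
      ‖y‖ ≤ R → |u i ε y| ≤ C * (ε : ℝ)⁻¹ ^ N := by
  choose N hN C hC using fun i => (hu i).2 R
  -- The sum of the exponents stays in `S` and dominates each of them.
  refine ⟨∑ i, N i, S.sum_mem fun i _ => hN i, ∑ i, |C i|,
    Finset.sum_nonneg fun i _ => abs_nonneg _, ?_⟩
  filter_upwards [eventually_all.2 hC] with ε hε i y hy
  have h1 := le_inv_pow_of_le ((∑ l, N l) - N i) (hε i y hy)
  have h2 : N i ≤ ∑ l, N l := Finset.single_le_sum (fun _ _ => Nat.zero_le _) (Finset.mem_univ i)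
  rw [Nat.add_sub_cancel' h2] at h1
  have h3 := one_le_inv_pow ε (∑ l, N l)
  refine h1.trans ?_
  gcongr
  exact Finset.single_le_sum (f := fun l => |C l|) (fun _ _ => abs_nonneg _) (Finset.mem_univ i)

theorem Growth.uniform_bot {n : ℕ} {ι : Type*} [Fintype ι] {u : ι → Net n}
    (hu : ∀ i, Growth ⊥ (u i)) (R : ℝ) : ∃ C : ℝ, 0 ≤ C ∧ ∀ᶠ ε : Eps in atBot, ∀ i y,
      ‖y‖ ≤ R → |u i ε y| ≤ C := by
  obtain ⟨N, hN, C, hC0, hC⟩ := Growth.uniform hu R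
  obtain rfl : N = 0 := by simpa using hN
  exact ⟨C, hC0, by simpa using hC⟩

/-- Nothing is known about the growth of `f` at infinity, so the inner nets must be uniformly
bounded; then `f` is only evaluated on a compact ball, whatever `S` is. -/
theorem growth_comp {n m : ℕ} (S : AddSubmonoid ℕ) {f : (Fin m → ℝ) → ℝ} (hf : ContDiff ℝ ∞ f)
    {x : Fin m → Net n} (hx : ∀ i, Growth ⊥ (x i)) : Growth S (Net.comp f x) := by
  refine ⟨smooth_comp hf fun i => (hx i).1, fun R => ?_⟩
  obtain ⟨C, hC0, hC⟩ := Growth.uniform_bot hx R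
  obtain ⟨M, hM⟩ := (isCompact_closedBall (0 : Fin m → ℝ) C).exists_bound_of_continuousOn
    hf.continuous.continuousOn
  refine ⟨0, S.zero_mem, M, ?_⟩
  filter_upwards [hC] with ε hε y hy
  simp only [pow_zero, mul_one]
  refine hM _ (mem_closedBall_zero_iff.2 ((pi_norm_le_iff_of_nonneg hC0).2 fun i => ?_))
  exact hε i y hy

theorem Growth.reindex {n m : ℕ} {S : AddSubmonoid ℕ} {u : Net m} (hu : Growth S u)
    (σ : Fin m → Fin n) : Growth S (u.reindex σ) := by
  refine ⟨hu.1.reindex σ, fun R => ?_⟩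
  obtain ⟨N, hN, C, hC⟩ := hu.2 R
  refine ⟨N, hN, C, ?_⟩
  filter_upwards [hC] with ε hε y hy
  refine hε _ ?_
  have hR := (norm_nonneg y).trans hy
  exact (pi_norm_le_iff_of_nonneg hR).2 fun i => (norm_le_pi_norm y (σ i)).trans hy

/-! ### Growth of derivatives -/

/-- All derivatives of order at most `k` in the directions of `J` satisfy the growth condition. -/
def DerivGrowth {n : ℕ} (S : AddSubmonoid ℕ) (J : Set (Fin n)) : ℕ → Net n → Prop
  | 0, u => Growth S u
  | k + 1, u => Growth S u ∧ ∀ j ∈ J, DerivGrowth S J k (pd j u)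

section
variable {n : ℕ} {S : AddSubmonoid ℕ} {J : Set (Fin n)} {k : ℕ} {u w : Net n}

theorem DerivGrowth.growth (hu : DerivGrowth S J k u) : Growth S u := by
  cases k with
  | zero => exact hu
  | succ k => exact hu.1

theorem DerivGrowth.smooth (hu : DerivGrowth S J k u) : u.Smooth := hu.growth.1

theorem DerivGrowth.of_succ (hu : DerivGrowth S J (k + 1) u) : DerivGrowth S J k u := by
  induction k generalizing u with
  | zero => exact hu.1
  | succ k ih => exact ⟨hu.1, fun j hj => ih (hu.2 j hj)⟩

theorem derivGrowth_constNet (c : ℝ) : DerivGrowth S J k (constNet n c) := by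
  induction k generalizing c with
  | zero => exact growth_constNet S c
  | succ k ih => exact ⟨growth_constNet S c, fun j _ => by rw [pd_constNet]; exact ih 0⟩

theorem DerivGrowth.add (hu : DerivGrowth S J k u) (hw : DerivGrowth S J k w) :
    DerivGrowth S J k (u + w) := by
  induction k generalizing u w with
  | zero => exact Growth.add hu hw
  | succ k ih =>
    refine ⟨hu.1.add hw.1, fun j hj => ?_⟩
    rw [pd_add j hu.smooth hw.smooth]
    exact ih (hu.2 j hj) (hw.2 j hj)

theorem DerivGrowth.mul (hu : DerivGrowth S J k u) (hw : DerivGrowth S J k w) :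
    DerivGrowth S J k (u * w) := by
  induction k generalizing u w with
  | zero => exact Growth.mul hu hw
  | succ k ih =>
    refine ⟨hu.1.mul hw.1, fun j hj => ?_⟩
    rw [pd_mul j hu.smooth hw.smooth]
    exact (ih (hu.2 j hj) hw.of_succ).add (ih hu.of_succ (hw.2 j hj))

theorem DerivGrowth.sum {ι : Type*} {s : Finset ι} {u : ι → Net n}
    (hu : ∀ i, DerivGrowth S J k (u i)) : DerivGrowth S J k (∑ i ∈ s, u i) := by
  classical
  induction s using Finset.induction_on with
  | empty => simpa [constNet_zero] using derivGrowth_constNet (n := n) (S := S) (J := J) (k := k) 0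
  | insert i s hi ih =>
    rw [Finset.sum_insert hi]
    exact (hu i).add ih

theorem derivGrowth_comp {m : ℕ} {f : (Fin m → ℝ) → ℝ} (hf : ContDiff ℝ ∞ f)
    {x : Fin m → Net n} (hb : ∀ i, Growth ⊥ (x i)) (hx : ∀ i, DerivGrowth S J k (x i)) :
    DerivGrowth S J k (Net.comp f x) := by
  induction k generalizing f with
  | zero => exact growth_comp S hf hb
  | succ k ih =>
    refine ⟨growth_comp S hf hb, fun j hj => ?_⟩
    rw [pd_comp j hf fun i => (hb i).1]
    exact DerivGrowth.sum fun i =>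
      (ih (partialDeriv_contDiff i hf) fun l => (hx l).of_succ).mul ((hx i).2 j hj)

theorem DerivGrowth.reindex {m : ℕ} {u : Net m} (hu : DerivGrowth S Set.univ k u)
    (σ : Fin m → Fin n) : DerivGrowth S J k (u.reindex σ) := by
  induction k generalizing u with
  | zero => exact Growth.reindex hu σ
  | succ k ih =>
    refine ⟨hu.1.reindex σ, fun j hj => ?_⟩
    rw [pd_reindex j σ hu.smooth]
    exact DerivGrowth.sum fun i => (derivGrowth_constNet _).mul (ih (hu.2 i trivial))

theorem DerivGrowth.iterate_pd (hu : ∀ k, DerivGrowth S J k u) {j : Fin n} (hj : j ∈ J) (m : ℕ) :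
    ∀ k, DerivGrowth S J k ((pd j)^[m] u) := by
  induction m with
  | zero => exact hu
  | succ m ih =>
    intro k
    rw [Function.iterate_succ_apply']
    exact (ih (k + 1)).2 j hj

end

/-! ### Estimates for curves driven by a concentrated force -/

section Curves
variable {E : Type*} [NormedAddCommGroup E] [NormedSpace ℝ E] {y y' y'' : ℝ → E} {d : ℝ → ℝ}

/-- The right-hand side is a primitive of the bound on `‖y'‖`, so a comparison of derivatives
suffices and `y'` need not be integrated. -/
theorem norm_sub_le_of_norm_deriv_le {A B a b : ℝ} (hy : ∀ u, HasDerivAt y (y' u) u)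
    (hd : Continuous d) (h : ∀ u ∈ Set.Ico a b, ‖y' u‖ ≤ A * |d u| + B) {u : ℝ}
    (hu : u ∈ Set.Icc a b) :
    ‖y u - y a‖ ≤ A * (∫ r in a..u, |d r|) + B * (u - a) := by
  have hB : ∀ s, HasDerivAt (fun s => A * (∫ r in a..s, |d r|) + B * (s - a))
      (A * |d s| + B) s := by
    intro s
    have h1 := (hd.abs.integral_hasStrictDerivAt a s).hasDerivAt.const_mul A
    have h2 := ((hasDerivAt_id s).sub_const a).const_mul B
    exact (h1.add h2).congr_deriv (by simp)
  refine image_norm_le_of_norm_deriv_right_le_deriv_boundary (f := fun s => y s - y a) (f' := y')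
    (fun s _ => ((hy s).sub_const _).continuousAt.continuousWithinAt)
    (fun s _ => ((hy s).sub_const _).hasDerivWithinAt) (by simp) hB h hu

theorem norm_sub_le_mul {B a b : ℝ} (hy : ∀ u, HasDerivAt y (y' u) u)
    (h : ∀ u ∈ Set.Ico a b, ‖y' u‖ ≤ B) {u : ℝ} (hu : u ∈ Set.Icc a b) :
    ‖y u - y a‖ ≤ B * (u - a) := by
  simpa using norm_sub_le_of_norm_deriv_le (A := 0) (d := fun _ => 0) hy continuous_const
    (by simpa using h) hu

/-- A continuous function which vanishes off `[-e, e]` and whose absolute value has integral at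
most `C`. -/
structure IsPulse (d : ℝ → ℝ) (e C : ℝ) : Prop where
  continuous : Continuous d
  pos : 0 < e
  le_one : e ≤ 1
  nonneg : 0 ≤ C
  zero : ∀ u, u ∉ Set.Icc (-e) e → d u = 0
  integral_le : ∫ r, |d r| ≤ C

theorem IsPulse.intervalIntegral_le {e C : ℝ} (hd : IsPulse d e C) {a u : ℝ} (h : a ≤ u) :
    ∫ r in a..u, |d r| ≤ C := by
  have hi : Integrable fun r => |d r| := by
    refine (hd.continuous.integrable_of_hasCompactSupport ?_).abs
    exact HasCompactSupport.of_support_subset_isCompact (isCompact_Icc (a := -e) (b := e))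
      fun u hu => by_contra fun h => hu (hd.zero u h)
  rw [intervalIntegral.integral_of_le h]
  exact (setIntegral_le_integral hi (Eventually.of_forall fun r => abs_nonneg _)).trans
    hd.integral_le

variable {e C T A B : ℝ}

theorem IsPulse.norm_deriv_le (hd : IsPulse d e C) (hA : 0 ≤ A) (hB : 0 ≤ B)
    (hy' : ∀ u, HasDerivAt y' (y'' u) u) (h0 : y' (-1) = 0)
    (h : ∀ u ∈ Set.Ico (-1) T, ‖y'' u‖ ≤ A * |d u| + B) {u : ℝ} (hu : u ∈ Set.Icc (-1) T) :
    ‖y' u‖ ≤ A * C + B * (T + 1) := by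
  have h1 := norm_sub_le_of_norm_deriv_le hy' hd.continuous h hu
  rw [h0, sub_zero] at h1
  have h2 := hd.intervalIntegral_le hu.1
  have h3 : u - -1 ≤ T + 1 := by linarith [hu.2]
  exact h1.trans (by gcongr)

/-- Up to the end of the pulse, the strength `A` enters only with the factor `e`: before `-e` the
pulse is silent, and within `[-e, e]` the bounded velocity acts for a time of at most `2e`. This
small factor drives both the continuity argument and the absorption argument. -/
theorem IsPulse.norm_sub_le (hd : IsPulse d e C) (hA : 0 ≤ A) (hB : 0 ≤ B)
    (hy : ∀ u, HasDerivAt y (y' u) u) (hy' : ∀ u, HasDerivAt y' (y'' u) u) (h0 : y' (-1) = 0)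
    (h : ∀ u ∈ Set.Ico (-1) T, ‖y'' u‖ ≤ A * |d u| + B) {u : ℝ} (hu : u ∈ Set.Icc (-1) T)
    (hue : u ≤ e) :
    ‖y u - y (-1)‖ ≤ B * (T + 1) ^ 2 + 2 * e * (A * C + B * (T + 1)) := by
  have hT : 0 ≤ T + 1 := by linarith [hu.1, hu.2]
  have he := hd.pos
  have hC := hd.nonneg
  have early : ∀ s ∈ Set.Icc (-1) T, s ≤ -e → ‖y s - y (-1)‖ ≤ B * (T + 1) ^ 2 := by
    intro s hs hse
    have h1 : ∀ r ∈ Set.Ico (-1) s, ‖y' r‖ ≤ B * (T + 1) := by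
      intro r hr
      have h2 := norm_sub_le_mul (B := B) hy' (a := -1) (b := s) (fun t ht => by
        have h3 := h t ⟨ht.1, ht.2.trans_le hs.2⟩
        rwa [hd.zero t fun h4 => by linarith [h4.1, ht.2], abs_zero, mul_zero, zero_add] at h3)
        ⟨hr.1, hr.2.le⟩
      rw [h0, sub_zero] at h2
      refine h2.trans ?_
      gcongr
      linarith [hr.2, hs.2]
    refine (norm_sub_le_mul hy h1 ⟨hs.1, le_rfl⟩).trans ?_
    rw [pow_two, ← mul_assoc]
    gcongr
    linarith [hs.2]
  rcases le_or_gt u (-e) with h1 | h1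
  · exact (early u hu h1).trans (by linarith [show 0 ≤ 2 * e * (A * C + B * (T + 1)) by positivity])
  · have h2 := early (-e) ⟨by linarith [hd.le_one], h1.le.trans hu.2⟩ le_rfl
    have h3 := norm_sub_le_mul (B := A * C + B * (T + 1)) hy (a := -e) (b := u) (fun r hr =>
      hd.norm_deriv_le hA hB hy' h0 h ⟨by linarith [hd.le_one, hr.1], hr.2.le.trans hu.2⟩)
      ⟨h1.le, le_rfl⟩
    have h4 : (A * C + B * (T + 1)) * (u - -e) ≤ 2 * e * (A * C + B * (T + 1)) := by
      rw [mul_comm]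
      gcongr
      linarith
    calc ‖y u - y (-1)‖ = ‖(y (-e) - y (-1)) + (y u - y (-e))‖ := by congr 1; abel
      _ ≤ _ := (norm_add_le _ _).trans (add_le_add h2 (h3.trans h4))

/-- A priori estimate for linear equations with a short pulse as coefficient. -/
theorem exists_bound_linear_pulse {M C T : ℝ} (hM : 0 ≤ M) (hC : 0 ≤ C) (hT : 1 ≤ T) :
    ∃ K : ℝ, 0 ≤ K ∧ ∀ (y y' y'' : ℝ → E) (d : ℝ → ℝ) (e H c : ℝ), IsPulse d e C →
      4 * e * M * C ≤ 1 → 0 ≤ H →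
      (∀ u, HasDerivAt y (y' u) u) → (∀ u, HasDerivAt y' (y'' u) u) → y' (-1) = 0 → ‖y (-1)‖ ≤ c →
      (∀ u ∈ Set.Icc (-1) T, ‖y'' u‖ ≤ (M * ‖y u‖ + H) * |d u| + H) →
      ∀ u ∈ Set.Icc (-1) T, ‖y u‖ ≤ K * (c + H) ∧ ‖y' u‖ ≤ K * (c + H) := by
  set W := T + 1 with hW
  have hW0 : 0 ≤ W := by linarith
  -- `K₁` will control the maximum of `‖y‖` over the pulse, and `K₂` the velocity on all of `[-1,
  -- T]`.
  set K₁ := 4 * (1 + W ^ 2 + C + W) with hK₁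
  set K₂ := (M * K₁ + 1) * C + W with hK₂
  have hK₁0 : 0 ≤ K₁ := by positivity
  have hK₂0 : 0 ≤ K₂ := by positivity
  refine ⟨1 + K₂ * W + K₂, by positivity, fun y y' y'' d e H c hd hsmall hH hy hy' h0 hc h => ?_⟩
  have hc0 : 0 ≤ c := (norm_nonneg _).trans hc
  have he := hd.pos
  have he1 := hd.le_one
  -- Off `[-e, e]` the coefficient of `‖y u‖` vanishes, so the force is controlled by the maximum
  -- over the pulse alone.
  obtain ⟨s, hs, hmax⟩ := isCompact_Icc.exists_isMaxOn (Set.nonempty_Icc.2 (by linarith : -e ≤ e))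
    (continuous_iff_continuousAt.2 fun u => (hy u).continuousAt).norm.continuousOn
  set Y := ‖y s‖ with hY
  have hY0 : 0 ≤ Y := norm_nonneg _
  have h2 : ∀ u ∈ Set.Ico (-1) T, ‖y'' u‖ ≤ (M * Y + H) * |d u| + H := by
    intro u hu
    refine (h u ⟨hu.1, hu.2.le⟩).trans ?_
    by_cases hue : u ∈ Set.Icc (-e) e
    · have : ‖y u‖ ≤ Y := hmax hue
      gcongr
    · simp [hd.zero u hue]
  have hA : 0 ≤ M * Y + H := by positivity
  have hsT : s ∈ Set.Icc (-1) T := ⟨by linarith [hs.1], by linarith [hs.2]⟩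
  have h3 := hd.norm_sub_le hA hH hy hy' h0 h2 hsT hs.2
  have h4 : Y ≤ c + (H * W ^ 2 + 2 * e * ((M * Y + H) * C + H * W)) := by
    calc Y = ‖y (-1) + (y s - y (-1))‖ := by rw [hY]; congr 1; abel
      _ ≤ _ := (norm_add_le _ _).trans (add_le_add hc h3)
  -- Absorption: the smallness `4 * e * M * C ≤ 1` lets this half of `Y` move to the left side of
  -- `h4`.
  have h5 : 2 * e * (M * Y * C) ≤ Y / 2 := by nlinarith
  have h6 : 2 * e * (H * C + H * W) ≤ 2 * (H * C + H * W) := by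
    have : 0 ≤ H * C + H * W := by positivity
    nlinarith
  have h7 : Y ≤ K₁ * (c + H) := by
    have e1 : 0 ≤ c * W ^ 2 := by positivity
    have e2 : 0 ≤ c * C := by positivity
    have e3 : 0 ≤ c * W := by positivity
    have e4 : 0 ≤ H * W ^ 2 := by positivity
    have e5 : 0 ≤ H * C := by positivity
    have e6 : 0 ≤ H * W := by positivity
    rw [hK₁]
    nlinarith
  intro u hu
  have h8 : (M * Y + H) * C + H * W ≤ K₂ * (c + H) := by
    calc (M * Y + H) * C + H * W ≤ (M * (K₁ * (c + H)) + (c + H)) * C + (c + H) * W := by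
          gcongr <;> linarith
      _ = _ := by rw [hK₂]; ring
  have h9 : ∀ r ∈ Set.Icc (-1) T, ‖y' r‖ ≤ K₂ * (c + H) := fun r hr =>
    (hd.norm_deriv_le hA hH hy' h0 h2 hr).trans h8
  have h10 := norm_sub_le_mul hy (fun r hr => h9 r ⟨hr.1, hr.2.le⟩) hu
  have h11 : K₂ * (c + H) * (u - -1) ≤ K₂ * (c + H) * W := by
    gcongr
    linarith [hu.2]
  have e1 : 0 ≤ K₂ * (c + H) := by positivity
  have e2 : 0 ≤ K₂ * W * (c + H) := by positivity
  constructor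
  · calc ‖y u‖ = ‖y (-1) + (y u - y (-1))‖ := by congr 1; abel
      _ ≤ c + K₂ * (c + H) * W := (norm_add_le _ _).trans (add_le_add hc (h10.trans h11))
      _ ≤ _ := by nlinarith
  · exact (h9 u hu).trans (by nlinarith)
end Curves

/-! ### Strict delta nets as functions of one coordinate -/

/-- The net `y ↦ δ_ε(y_p)`. -/
def timeNet {n : ℕ} (p : Fin n) (δ : Eps → ℝ → ℝ) : Net n := fun ε y => δ ε (y p)

theorem IsStrictDelta.exists_isPulse {δ : Eps → ℝ → ℝ} (hδ : IsStrictDelta δ) :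
    ∃ C : ℝ, 0 ≤ C ∧ ∀ᶠ ε : Eps in atBot, IsPulse (δ ε) ε C := by
  obtain ⟨C, hC, ε₀, h⟩ := hδ.integral_abs_le
  refine ⟨C, hC.le, eventually_atBot.2 ⟨ε₀, fun ε hε => ?_⟩⟩
  exact ⟨(hδ.smooth ε).continuous, ε.2.1, ε.2.2, hC.le,
    fun u hu => image_eq_zero_of_notMem_tsupport fun h => hu (hδ.supp ε h), h ε hε⟩

theorem IsStrictDelta.smooth_timeNet {δ : Eps → ℝ → ℝ} (hδ : IsStrictDelta δ) {n : ℕ}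
    (p : Fin n) : (timeNet p δ).Smooth :=
  fun ε => (hδ.smooth ε).comp (contDiff_apply ℝ ℝ p)

theorem growth_of_derivBound {n : ℕ} {u : Net n} (hu : u.Smooth) (α : Fin n → ℕ)
    (h : ∀ K : Set (Fin n → ℝ), IsCompact K → ∃ N : ℕ, DerivBound u K α (-(N : ℤ))) :
    Growth ⊤ (fun ε => multiDeriv α (u ε)) := by
  -- Smoothness of the iterated derivative is read off from the first component of
  -- `multiDeriv_lincomb`, with zero coefficients.
  refine ⟨fun ε => contDiffOn_univ.1 (multiDeriv_lincomb ⊤ α 0 0 (u := u ε) (w := u ε)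
    (s := fun _ => 0) ⟨(hu ε).contDiffOn, (hu ε).contDiffOn, by simp⟩).1, fun R => ?_⟩
  obtain ⟨N, C, ε₀, hC⟩ := h _ (isCompact_closedBall 0 R)
  refine ⟨N, trivial, C, eventually_atBot.2 ⟨ε₀, fun ε hε y hy => ?_⟩⟩
  have := hC ε hε y (mem_closedBall_zero_iff.2 hy)
  rwa [zpow_neg, zpow_natCast, ← inv_pow] at this

theorem IsStrictDelta.derivGrowth_timeNet {δ : Eps → ℝ → ℝ} (hδ : IsStrictDelta δ) {n : ℕ}
    (p : Fin n) (J : Set (Fin n)) (k : ℕ) : DerivGrowth ⊤ J k (timeNet p δ) := by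
  set u : Net 1 := fun ε y => δ ε (y 0) with hu
  have hs : u.Smooth := fun ε => (hδ.smooth ε).comp (contDiff_apply ℝ ℝ 0)
  have h1 : ∀ m, Growth ⊤ ((pd 0)^[m] u) := by
    intro m
    have h2 := growth_of_derivBound hs (fun _ => m) fun K hK => hδ.moderate.2 K hK (by simp) _
    convert h2 using 1
    clear h2
    funext ε
    simp only [multiDeriv, List.finRange_succ, List.finRange_zero, List.map_nil, List.foldr_cons,
      List.foldr_nil]
    induction m with
    | zero => rfl
    | succ m ih => simp only [Function.iterate_succ_apply', ← ih, pd]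
  have h3 : ∀ k m, DerivGrowth ⊤ Set.univ k ((pd 0)^[m] u) := by
    intro k
    induction k with
    | zero => exact h1
    | succ k ih =>
      refine fun m => ⟨h1 m, fun j _ => ?_⟩
      rw [Subsingleton.elim j 0, ← Function.iterate_succ_apply' (pd 0) m u]
      exact ih (m + 1)
  exact (h3 k 0).reindex fun _ => p

theorem IsStrictDelta.pd_timeNet {δ : Eps → ℝ → ℝ} (hδ : IsStrictDelta δ) {n : ℕ}
    {p j : Fin n} (hj : j ≠ p) : pd j (timeNet p δ) = constNet n 0 := by
  have hs : Net.Smooth (fun ε y => δ ε (y 0) : Net 1) :=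
    fun ε => (hδ.smooth ε).comp (contDiff_apply ℝ ℝ 0)
  have h := pd_reindex j (fun _ => p) hs
  rw [Finset.sum_eq_zero] at h
  · exact h
  · intro i _
    rw [if_neg hj.symm, constNet_zero, zero_mul]

/-! ### Growth of solutions -/

theorem norm_update_le {n : ℕ} {y : Fin n → ℝ} {R s : ℝ} (p : Fin n) (hy : ‖y‖ ≤ R)
    (hs : |s| ≤ R) : ‖Function.update y p s‖ ≤ R := by
  refine (pi_norm_le_iff_of_nonneg ((norm_nonneg y).trans hy)).2 fun i => ?_
  by_cases h : i = p
  · subst h; simpa using hs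
  · rw [Function.update_of_ne h]; exact (norm_le_pi_norm y i).trans hy

/-- For `ε < 1/2` the kick has not begun in this region, which contains the initial time `-1`.
Imposing initial conditions on an open set instead of a hyperplane allows them to be differentiated
in every direction. -/
theorem isOpen_early {n : ℕ} (p : Fin n) : IsOpen {y : Fin n → ℝ | y p < -1 / 2} :=
  isOpen_lt (continuous_apply p) continuous_const

theorem hasDerivAt_curve {n : ℕ} {p : Fin n} {ι : Type*} {z : ι → Net n}
    (hz : ∀ i, (z i).Smooth) (ε : Eps) (y : Fin n → ℝ) (u : ℝ) :
    HasDerivAt (fun s i => z i ε (Function.update y p s))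
      (fun i => pd p (z i) ε (Function.update y p u)) u :=
  hasDerivAt_pi.2 fun i => hasDerivAt_comp_update p ((hz i).differentiable ε) y u

section
variable {n : ℕ} {p : Fin n} {δ : Eps → ℝ → ℝ} {ι : Type*} [Fintype ι]

/-- `exists_bound_linear_pulse` applies along each line in direction `p`. Its bound is linear in the
data with a constant independent of `ε`, so the exponent of `r` and `h` is passed on unchanged. -/
theorem growth_of_linear_system (hδ : IsStrictDelta δ) {S : AddSubmonoid ℕ}
    {a : ι → ι → Net n} {r h z : ι → Net n} {c : ι → ℝ}
    (ha : ∀ i l, Growth ⊥ (a i l)) (hr : ∀ i, Growth S (r i)) (hh : ∀ i, Growth S (h i))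
    (hz : ∀ i, (z i).Smooth)
    (heq : ∀ i, EvEqOn Set.univ (pd p (pd p (z i)))
      (∑ l, a i l * z l * timeNet p δ + r i * timeNet p δ + h i))
    (init : ∀ i, EvEqOn {y | y p < -1 / 2} (z i) (constNet n (c i))) (i : ι) :
    Growth S (z i) ∧ Growth S (pd p (z i)) := by
  suffices H : ∀ R : ℝ, ∃ N ∈ S, ∃ B : ℝ, ∀ᶠ ε : Eps in atBot, ∀ y, ‖y‖ ≤ R →
      |z i ε y| ≤ B * (ε : ℝ)⁻¹ ^ N ∧ |pd p (z i) ε y| ≤ B * (ε : ℝ)⁻¹ ^ N by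
    refine ⟨⟨hz i, fun R => ?_⟩, ⟨(hz i).pd p, fun R => ?_⟩⟩ <;> obtain ⟨N, hN, B, hB⟩ := H R
    · exact ⟨N, hN, B, hB.mono fun ε h y hy => (h y hy).1⟩
    · exact ⟨N, hN, B, hB.mono fun ε h y hy => (h y hy).2⟩
  intro R₀
  -- With `R ≥ 1`, replacing the time coordinate of a point of the ball by any value in `[-1, R]`
  -- stays in the ball.
  obtain ⟨R, hR₀, hR1⟩ : ∃ R, R₀ ≤ R ∧ 1 ≤ R := ⟨max R₀ 1, le_max_left _ _, le_max_right _ _⟩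
  obtain ⟨C, hC0, hpulse⟩ := hδ.exists_isPulse
  obtain ⟨M, hM0, hM⟩ := Growth.uniform_bot (u := fun q : ι × ι => a q.1 q.2)
    (fun q => ha q.1 q.2) R
  obtain ⟨N, hN, Q, hQ0, hQ⟩ := Growth.uniform (u := fun q : ι ⊕ ι => Sum.elim r h q)
    (by rintro (q | q); exacts [hr q, hh q]) R
  obtain ⟨K, hK0, hK⟩ := exists_bound_linear_pulse (E := ι → ℝ) (M := Fintype.card ι * M)
    (C := C) (T := R) (by positivity) hC0 hR1
  -- The extra `‖c‖` covers the points with `y p < -1 / 2`, where `z` still has its initial value.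
  refine ⟨N, hN, K * (‖c‖ + Q) + ‖c‖, ?_⟩
  have hsmall : ∀ᶠ ε : Eps in atBot, (ε : ℝ) < 1 / (4 * (Fintype.card ι * M) * C + 1) :=
    eventually_lt_of_pos (by positivity)
  filter_upwards [hpulse, hM, hQ, hsmall, eventually_all.2 fun i => heq i R,
    eventually_all.2 fun i => init i R, eventually_all.2 fun i => (init i).pd (isOpen_early p) p R]
    with ε hε hMε hQε hsε heqε hiε hiε' y hy₀
  have hy := hy₀.trans hR₀
  have hone := one_le_inv_pow ε N
  have hc0 := norm_nonneg c
  rcases lt_or_ge (y p) (-1 / 2) with hyp | hyp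
  · have h1 : |c i| ≤ (K * (‖c‖ + Q) + ‖c‖) * (ε : ℝ)⁻¹ ^ N := by
      have h2 : ‖c‖ ≤ K * (‖c‖ + Q) + ‖c‖ := le_add_of_nonneg_left (by positivity)
      exact (norm_le_pi_norm c i).trans (h2.trans (le_mul_of_one_le_right (by positivity) hone))
    rw [hiε i y hyp hy, hiε' i y hyp hy, pd_constNet]
    refine ⟨h1, ?_⟩
    simpa [constNet] using (abs_nonneg _).trans h1
  · have hpR : ‖y p‖ ≤ R := (norm_le_pi_norm y p).trans hy
    rw [Real.norm_eq_abs, abs_le] at hpR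
    have hm1 : ‖Function.update y p (-1)‖ ≤ R := norm_update_le p hy (by simpa using hR1)
    have hm2 : Function.update y p (-1) p < -1 / 2 := by norm_num
    have key := hK (fun s i => z i ε (Function.update y p s))
      (fun s i => pd p (z i) ε (Function.update y p s))
      (fun s i => pd p (pd p (z i)) ε (Function.update y p s)) (δ ε) ε (Q * (ε : ℝ)⁻¹ ^ N) ‖c‖ hε
      ?_ (by positivity) (hasDerivAt_curve hz ε y) (hasDerivAt_curve (fun i => (hz i).pd p) ε y)
      ?_ ?_ ?_ (y p) ⟨by linarith, hpR.2⟩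
    · simp only [Function.update_eq_self] at key
      have h2 : K * (‖c‖ + Q * (ε : ℝ)⁻¹ ^ N) ≤ (K * (‖c‖ + Q) + ‖c‖) * (ε : ℝ)⁻¹ ^ N := by
        calc K * (‖c‖ + Q * (ε : ℝ)⁻¹ ^ N) ≤ K * (‖c‖ * (ε : ℝ)⁻¹ ^ N + Q * (ε : ℝ)⁻¹ ^ N) := by
              gcongr
              exact le_mul_of_one_le_right hc0 hone
          _ = K * (‖c‖ + Q) * (ε : ℝ)⁻¹ ^ N := by ring
          _ ≤ _ := by gcongr; exact le_add_of_nonneg_right hc0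
      exact ⟨(norm_le_pi_norm (fun i => z i ε y) i).trans (key.1.trans h2),
        (norm_le_pi_norm (fun i => pd p (z i) ε y) i).trans (key.2.trans h2)⟩
    · rw [lt_div_iff₀ (by positivity)] at hsε
      nlinarith [ε.2.1]
    · funext i
      rw [hiε' i _ hm2 hm1, pd_constNet]
      rfl
    · refine (pi_norm_le_iff_of_nonneg hc0).2 fun i => ?_
      rw [hiε i _ hm2 hm1]
      exact norm_le_pi_norm c i
    · intro s hs
      have hw : ‖Function.update y p s‖ ≤ R :=
        norm_update_le p hy (abs_le.2 ⟨by linarith [hs.1], hs.2⟩)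
      set w := Function.update y p s with hwd
      have hwp : w p = s := by simp [hwd]
      refine (pi_norm_le_iff_of_nonneg (by positivity)).2 fun i => ?_
      rw [heqε i w trivial hw]
      simp only [Pi.add_apply, Finset.sum_apply, Pi.mul_apply, timeNet, hwp, ← Finset.sum_mul]
      have h1 : ‖∑ l, a i l ε w * z l ε w‖ ≤ Fintype.card ι * M * ‖fun i => z i ε w‖ := by
        refine (norm_sum_le _ _).trans ((Finset.sum_le_card_nsmul _ _ (M * ‖fun i => z i ε w‖)
          fun l _ => ?_).trans_eq (by simp [mul_assoc]))
        rw [norm_mul]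
        exact mul_le_mul (hMε (i, l) w hw) (norm_le_pi_norm (fun i => z i ε w) l)
          (norm_nonneg _) hM0
      have h2 : ‖r i ε w‖ ≤ Q * (ε : ℝ)⁻¹ ^ N := hQε (Sum.inl i) w hw
      have h3 : ‖h i ε w‖ ≤ Q * (ε : ℝ)⁻¹ ^ N := hQε (Sum.inr i) w hw
      rw [← add_mul]
      refine (norm_add_le _ _).trans (add_le_add ?_ h3)
      rw [norm_mul, Real.norm_eq_abs (δ ε s)]
      gcongr
      exact (norm_add_le _ _).trans (add_le_add h1 h2)

/-- The derivative of a solution in a direction of `J` solves a system with the same `a` and zero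
initial data. The new `r` and `h` contain `z` itself, undifferentiated, and this is controlled by
the previous order; so `r`, `h`, `z` and `c` must vary in the induction. -/
theorem derivGrowth_of_linear_system (hδ : IsStrictDelta δ) {S : AddSubmonoid ℕ}
    {J : Set (Fin n)} (hJ : ∀ j ∈ J, ∀ k, DerivGrowth S J k (pd j (timeNet p δ)))
    {a : ι → ι → Net n} (ha : ∀ i l, Growth ⊥ (a i l)) (k : ℕ) :
    ∀ {r h z : ι → Net n} {c : ι → ℝ}, (∀ i l, DerivGrowth S J k (a i l)) →
      (∀ i, DerivGrowth S J k (r i)) → (∀ i, DerivGrowth S J k (h i)) → (∀ i, (z i).Smooth) →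
      (∀ i, EvEqOn Set.univ (pd p (pd p (z i)))
        (∑ l, a i l * z l * timeNet p δ + r i * timeNet p δ + h i)) →
      (∀ i, EvEqOn {y | y p < -1 / 2} (z i) (constNet n (c i))) →
      ∀ i, DerivGrowth S J k (z i) ∧ DerivGrowth S J k (pd p (z i)) := by
  induction k with
  | zero => exact fun _ hr hh hz heq init => growth_of_linear_system hδ ha hr hh hz heq init
  | succ k ih =>
    intro r h z c haJ hr hh hz heq init
    have prev := ih (fun i l => (haJ i l).of_succ) (fun i => (hr i).of_succ)
      (fun i => (hh i).of_succ) hz heq init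
    have hD : (timeNet p δ).Smooth := hδ.smooth_timeNet p
    have next : ∀ j ∈ J, ∀ i,
        DerivGrowth S J k (pd j (z i)) ∧ DerivGrowth S J k (pd p (pd j (z i))) := by
      intro j hj
      refine ih (r := fun i => ∑ l, pd j (a i l) * z l + pd j (r i))
        (h := fun i => ∑ l, a i l * z l * pd j (timeNet p δ) + r i * pd j (timeNet p δ) +
          pd j (h i)) (c := fun _ => 0) (fun i l => (haJ i l).of_succ) (fun i => ?_) (fun i => ?_)
        (fun i => (hz i).pd j) (fun i => ?_) (fun i => ?_)
      · exact (DerivGrowth.sum fun l => ((haJ i l).2 j hj).mul (prev l).1).add ((hr i).2 j hj)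
      · exact ((DerivGrowth.sum fun l => (((haJ i l).of_succ).mul (prev l).1).mul
          (hJ j hj k)).add ((hr i).of_succ.mul (hJ j hj k))).add ((hh i).2 j hj)
      · have h1 := (heq i).pd isOpen_univ j
        have hsa : ∀ l, (a i l * z l).Smooth := fun l => (ha i l).1.mul (hz l)
        have hsum : (∑ l, a i l * z l * timeNet p δ).Smooth :=
          Net.Smooth.sum fun l _ => (hsa l).mul hD
        have hrD : (r i * timeNet p δ).Smooth := (hr i).smooth.mul hD
        rw [pd_comm j p ((hz i).pd p), pd_comm j p (hz i), pd_add j (hsum.add hrD) (hh i).smooth,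
          pd_add j hsum hrD, pd_sum j _ fun l => (hsa l).mul hD, pd_mul j (hr i).smooth hD] at h1
        convert h1 using 1
        have h2 : ∀ l, pd j (a i l * z l * timeNet p δ) = a i l * pd j (z l) * timeNet p δ +
            pd j (a i l) * z l * timeNet p δ + a i l * z l * pd j (timeNet p δ) := by
          intro l
          rw [pd_mul j (hsa l) hD, pd_mul j (ha i l).1 (hz l)]
          ring
        simp only [h2, Finset.sum_add_distrib, add_mul, Finset.sum_mul]
        ring
      · have h1 := (init i).pd (isOpen_early p) j
        rwa [pd_constNet] at h1
    intro i
    refine ⟨⟨(prev i).1.growth, fun j hj => (next j hj i).1⟩,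
      ⟨(prev i).2.growth, fun j hj => ?_⟩⟩
    rw [pd_comm j p (hz i)]
    exact (next j hj i).2

/-- Solutions of `ẍ = F(x) δ` which start at rest remain bounded, together with their velocities. -/
theorem growth_of_nonlinear_system (hδ : IsStrictDelta δ) {m : ℕ} {F : Fin m → (Fin m → ℝ) → ℝ}
    (hF : ∀ i, Continuous (F i)) {q : Fin m → Fin n} (hq : ∀ i, q i ≠ p) {x : Fin m → Net n}
    (hx : ∀ i, (x i).Smooth)
    (heq : ∀ i, EvEqOn Set.univ (pd p (pd p (x i))) (Net.comp (F i) x * timeNet p δ))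
    (init : ∀ i, EvEqOn {y | y p < -1 / 2} (x i) (fun _ y => y (q i))) (i : Fin m) :
    Growth ⊥ (x i) ∧ Growth ⊥ (pd p (x i)) := by
  suffices H : ∀ R : ℝ, ∃ B : ℝ, ∀ᶠ ε : Eps in atBot, ∀ y, ‖y‖ ≤ R →
      |x i ε y| ≤ B ∧ |pd p (x i) ε y| ≤ B by
    refine ⟨⟨hx i, fun R => ?_⟩, ⟨(hx i).pd p, fun R => ?_⟩⟩ <;> obtain ⟨B, hB⟩ := H R
    · exact ⟨0, zero_mem _, B, hB.mono fun ε h y hy => by simpa using (h y hy).1⟩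
    · exact ⟨0, zero_mem _, B, hB.mono fun ε h y hy => by simpa using (h y hy).2⟩
  intro R₀
  obtain ⟨R, hR₀, hR1⟩ : ∃ R, R₀ ≤ R ∧ 1 ≤ R := ⟨max R₀ 1, le_max_left _ _, le_max_right _ _⟩
  obtain ⟨C, hC0, hpulse⟩ := hδ.exists_isPulse
  -- Radius `R + 1` holds every curve that starts in the ball of radius `R` and moves by at most 1.
  obtain ⟨M, hM⟩ := (isCompact_closedBall (0 : Fin m → ℝ) (R + 1)).exists_bound_of_continuousOn
    (f := fun w i => F i w) (continuous_pi hF).continuousOn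
  have hM0 : 0 ≤ M := (norm_nonneg _).trans (hM 0 (by simp; linarith))
  refine ⟨R + M * C * (R + 1), ?_⟩
  have hsmall : ∀ᶠ ε : Eps in atBot, (ε : ℝ) < 1 / (2 * (M * C) + 1) :=
    eventually_lt_of_pos (by positivity)
  filter_upwards [hpulse, hsmall, eventually_all.2 fun i => heq i R,
    eventually_all.2 fun i => init i R, eventually_all.2 fun i => (init i).pd (isOpen_early p) p R]
    with ε hε hsε heqε hiε hiε' y hy₀
  have hy := hy₀.trans hR₀
  have hR0 : 0 ≤ R := by linarith
  have hvel : ∀ i y, pd p (fun _ y => y (q i)) ε y = 0 := fun i y => by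
    simp [pd, partialDeriv_coord, hq i]
  rcases lt_or_ge (y p) (-1 / 2) with hyp | hyp
  · have h1 : |y (q i)| ≤ R := (norm_le_pi_norm y (q i)).trans hy
    have h2 : 0 ≤ M * C * (R + 1) := by positivity
    rw [hiε i y hyp hy, hiε' i y hyp hy, hvel]
    exact ⟨by linarith, by simpa using by linarith⟩
  have hpR : ‖y p‖ ≤ R := (norm_le_pi_norm y p).trans hy
  rw [Real.norm_eq_abs, abs_le] at hpR
  have hm1 : ‖Function.update y p (-1)‖ ≤ R := norm_update_le p hy (by simpa using hR1)
  have hm2 : Function.update y p (-1) p < -1 / 2 := by norm_num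
  set X : ℝ → Fin m → ℝ := fun s i => x i ε (Function.update y p s) with hX
  set X' : ℝ → Fin m → ℝ := fun s i => pd p (x i) ε (Function.update y p s) with hX'
  set X'' : ℝ → Fin m → ℝ := fun s i => pd p (pd p (x i)) ε (Function.update y p s) with hX''
  have hd : ∀ s, HasDerivAt X (X' s) s := hasDerivAt_curve hx ε y
  have hd' : ∀ s, HasDerivAt X' (X'' s) s := hasDerivAt_curve (fun i => (hx i).pd p) ε y
  have h0' : X' (-1) = 0 := by
    funext i
    simp only [hX', hiε' i _ hm2 hm1, hvel, Pi.zero_apply]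
  have h0 : ‖X (-1)‖ ≤ R := by
    refine (pi_norm_le_iff_of_nonneg hR0).2 fun i => ?_
    simp only [hX, hiε i _ hm2 hm1, Function.update_of_ne (hq i)]
    exact (norm_le_pi_norm y (q i)).trans hy
  have hacc : ∀ s ∈ Set.Icc (-1) R, ‖X s - X (-1)‖ ≤ 1 → ‖X'' s‖ ≤ M * |δ ε s| + 0 := by
    intro s hs h1
    have hw : ‖Function.update y p s‖ ≤ R :=
      norm_update_le p hy (abs_le.2 ⟨by linarith [hs.1], hs.2⟩)
    have h2 : X'' s = δ ε s • fun i => F i (X s) := by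
      funext i
      simp only [hX'', heqε i _ trivial hw]
      simp [timeNet, Net.comp, hX, mul_comm]
    have h3 : ‖X s‖ ≤ R + 1 := by
      calc ‖X s‖ = ‖X (-1) + (X s - X (-1))‖ := by congr 1; abel
        _ ≤ _ := (norm_add_le _ _).trans (add_le_add h0 h1)
    rw [h2, norm_smul, Real.norm_eq_abs, mul_comm, add_zero]
    gcongr
    exact hM _ (mem_closedBall_zero_iff.2 h3)
  have hXc : Continuous X := continuous_iff_continuousAt.2 fun s => (hd s).continuousAt
  -- Continuity argument: up to the first time `t` at which the displacement reaches 1 the force is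
  -- bounded by `M * |δ ε s|`, so the displacement at `t` is at most `2 * ε * M * C < 1`.
  have hstay : ∀ s ∈ Set.Icc (-1) (ε : ℝ), ‖X s - X (-1)‖ ≤ 1 := by
    by_contra! hcon
    obtain ⟨s₀, hs₀, hs₀'⟩ := hcon
    obtain ⟨t, ht, hmin⟩ := (isCompact_Icc.inter_right
      (isClosed_le continuous_const (hXc.sub continuous_const).norm) :
        IsCompact (Set.Icc (-1) (ε : ℝ) ∩ {s | 1 ≤ ‖X s - X (-1)‖})).exists_isLeast
      ⟨s₀, hs₀, hs₀'.le⟩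
    have hbefore : ∀ s ∈ Set.Ico (-1) t, ‖X'' s‖ ≤ M * |δ ε s| + 0 := by
      intro s hs
      refine hacc s ⟨hs.1, by linarith [hs.2, ht.1.2, hε.le_one]⟩ ?_
      by_contra! h1
      exact absurd (hmin ⟨⟨hs.1, hs.2.le.trans ht.1.2⟩, h1.le⟩) (not_le.2 hs.2)
    have h1 := hε.norm_sub_le hM0 le_rfl hd hd' h0' hbefore ⟨ht.1.1, le_rfl⟩ ht.1.2
    have h2 : 1 ≤ ‖X t - X (-1)‖ := ht.2
    rw [lt_div_iff₀ (by positivity)] at hsε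
    have := hε.pos
    nlinarith
  have hacc' : ∀ s ∈ Set.Ico (-1) R, ‖X'' s‖ ≤ M * |δ ε s| + 0 := by
    intro s hs
    by_cases h1 : s ≤ ε
    · exact hacc s ⟨hs.1, hs.2.le⟩ (hstay s ⟨hs.1, h1⟩)
    · have hw : ‖Function.update y p s‖ ≤ R :=
        norm_update_le p hy (abs_le.2 ⟨by linarith [hs.1], hs.2.le⟩)
      -- After the kick the motion is free, so no bound on the position is needed there.
      have h2 : X'' s = 0 := by
        funext i
        simp only [hX'', heqε i _ trivial hw]
        simp [timeNet, hε.zero s fun h => h1 h.2]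
      rw [h2, norm_zero]
      positivity
  have hX'b : ∀ s ∈ Set.Icc (-1) R, ‖X' s‖ ≤ M * C := fun s hs => by
    simpa using hε.norm_deriv_le hM0 le_rfl hd' h0' hacc' hs
  have hyp' : y p ∈ Set.Icc (-1) R := ⟨by linarith, hpR.2⟩
  have h1 := norm_sub_le_mul hd (fun s hs => hX'b s ⟨hs.1, hs.2.le⟩) hyp'
  have h2 : M * C * (y p - -1) ≤ M * C * (R + 1) := by
    gcongr
    linarith [hpR.2]
  have h3 : ‖X (y p)‖ ≤ R + M * C * (R + 1) := by
    calc ‖X (y p)‖ = ‖X (-1) + (X (y p) - X (-1))‖ := by congr 1; abel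
      _ ≤ _ := (norm_add_le _ _).trans (add_le_add h0 (h1.trans h2))
  have h4 := (norm_le_pi_norm _ i).trans h3
  have h5 := (norm_le_pi_norm _ i).trans (hX'b _ hyp')
  simp only [hX, hX', Function.update_eq_self, Real.norm_eq_abs] at h4 h5
  refine ⟨h4, h5.trans ?_⟩
  have : 0 ≤ M * C * R := by positivity
  nlinarith

end

/-! ### Moderate and c-bounded nets in terms of growth -/

/-- The net given by a coordinate. -/
def coordNet {n : ℕ} (i : Fin n) : Net n := fun _ y => y i

theorem pd_coordNet {n : ℕ} (i j : Fin n) :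
    pd j (coordNet i) = constNet n (if i = j then 1 else 0) := by
  funext ε y
  exact partialDeriv_coord i j y

theorem growth_coordNet {n : ℕ} (S : AddSubmonoid ℕ) (i : Fin n) : Growth S (coordNet i) :=
  ⟨fun _ => contDiff_apply ℝ ℝ i, fun R => ⟨0, S.zero_mem, R, Eventually.of_forall fun _ y hy => by
    simpa [coordNet] using (norm_le_pi_norm y i).trans hy⟩⟩

theorem derivGrowth_coordNet {n : ℕ} (S : AddSubmonoid ℕ) (J : Set (Fin n)) (k : ℕ) (i : Fin n) :
    DerivGrowth S J k (coordNet i) := by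
  cases k with
  | zero => exact growth_coordNet S i
  | succ k =>
    exact ⟨growth_coordNet S i, fun j _ => by rw [pd_coordNet]; exact derivGrowth_constNet _⟩

theorem derivGrowth_multiDeriv {n : ℕ} {S : AddSubmonoid ℕ} {J : Set (Fin n)} {u : Net n}
    (hu : ∀ k, DerivGrowth S J k u) {α : Fin n → ℕ} (hα : ∀ j ∉ J, α j = 0) (k : ℕ) :
    DerivGrowth S J k (fun ε => multiDeriv α (u ε)) := by
  have h1 : ∀ (j : Fin n) (m : ℕ) (w : Net n),
      (fun ε => (partialDeriv j)^[m] (w ε)) = (pd j)^[m] w := by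
    intro j m w
    induction m with
    | zero => rfl
    | succ m ih =>
      rw [Function.iterate_succ_apply', ← ih]
      simp only [Function.iterate_succ_apply']
      rfl
  unfold multiDeriv
  induction List.finRange n generalizing k with
  | nil => exact hu k
  | cons j l ih =>
    simp only [List.foldr_cons]
    rw [h1 j (α j) fun ε => List.foldr (fun j w => (partialDeriv j)^[α j] w) (u ε) l]
    by_cases hj : j ∈ J
    · exact DerivGrowth.iterate_pd ih hj _ k
    · rw [hα j hj]
      exact ih k

theorem exists_derivBound {n : ℕ} {ι : Type*} [Fintype ι] {u : ι → Net n}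
    (hu : ∀ i k, DerivGrowth ⊤ Set.univ k (u i)) {K : Set (Fin n → ℝ)} (hK : IsCompact K)
    (α : Fin n → ℕ) : ∃ N : ℕ, ∀ i, DerivBound (u i) K α (-(N : ℤ)) := by
  obtain ⟨R, hR⟩ := hK.isBounded.exists_norm_le
  obtain ⟨N, -, C, -, hC⟩ := Growth.uniform
    (fun i => (derivGrowth_multiDeriv (hu i) (α := α) (by simp) 0).growth) R
  obtain ⟨ε₀, hε₀⟩ := eventually_atBot.1 hC
  refine ⟨N, fun i => ⟨C, ε₀, fun ε hε y hy => ?_⟩⟩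
  rw [zpow_neg, zpow_natCast, ← inv_pow]
  exact hε₀ ε hε i y (hR y hy)

theorem mem_moderate_of_derivGrowth {n : ℕ} {u : Net n}
    (hu : ∀ k, DerivGrowth ⊤ Set.univ k u) : u ∈ moderate (⊤ : Opens (Fin n → ℝ)) := by
  refine ⟨fun ε => ((hu 0).smooth ε).contDiffOn, fun K hK _ α => ?_⟩
  obtain ⟨N, hN⟩ := exists_derivBound (ι := Unit) (u := fun _ => u) (fun _ => hu) hK α
  exact ⟨N, hN ()⟩

theorem mem_cBoundedNets_of_growth {n m : ℕ} {w : Eps → (Fin n → ℝ) → Fin m → ℝ}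
    (hb : ∀ i, Growth ⊥ (fun ε y => w ε y i))
    (hm : ∀ i k, DerivGrowth ⊤ Set.univ k (fun ε y => w ε y i)) :
    w ∈ cBoundedNets (⊤ : Opens (Fin n → ℝ)) (⊤ : Opens (Fin m → ℝ)) := by
  refine ⟨fun ε => ⟨(contDiff_pi.2 fun i => (hb i).1 ε).contDiffOn, fun _ _ => trivial⟩,
    fun K hK _ => ?_, fun K hK _ α => exists_derivBound hm hK α⟩
  obtain ⟨R, hR⟩ := hK.isBounded.exists_norm_le
  obtain ⟨C, hC0, hC⟩ := Growth.uniform_bot hb R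
  obtain ⟨ε₀, hε₀⟩ := eventually_atBot.1 hC
  refine ⟨Metric.closedBall 0 C, isCompact_closedBall 0 C, fun _ _ => trivial, ε₀,
    fun ε hε y hy => mem_closedBall_zero_iff.2 ((pi_norm_le_iff_of_nonneg hC0).2 fun i => ?_)⟩
  exact hε₀ ε hε i y (hR y hy)

/-! ### The geodesic equations as equations between nets -/

theorem eq_of_deriv_deriv_eq_zero {g : ℝ → ℝ} (hg : ContDiff ℝ ∞ g) {b t : ℝ} (ht : t < b)
    (h0 : deriv g t = 0) (h : ∀ u < b, deriv (deriv g) u = 0) {u : ℝ} (hu : u < b) :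
    g u = g t := by
  have hg' : ContDiff ℝ ∞ (deriv g) := ((contDiff_infty_iff_deriv).1 hg).2
  have h1 : ∀ s < b, deriv g s = 0 := fun s hs =>
    (isOpen_Iio.is_const_of_deriv_eq_zero isPreconnected_Iio
      (hg'.differentiable (by simp)).differentiableOn (fun r hr => h r hr) hs ht).trans h0
  exact isOpen_Iio.is_const_of_deriv_eq_zero isPreconnected_Iio
    (hg.differentiable (by simp)).differentiableOn (fun r hr => h1 r hr) hu ht

theorem deriv_comp_update {n : ℕ} (p : Fin n) {u : (Fin n → ℝ) → ℝ} (hu : ContDiff ℝ ∞ u)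
    (y : Fin n → ℝ) :
    deriv (fun s => u (Function.update y p s)) =
      fun s => partialDeriv p u (Function.update y p s) :=
  funext fun s => (hasDerivAt_comp_update p (hu.differentiable (by simp)) y s).deriv

theorem contDiff_comp_update {n : ℕ} (p : Fin n) {u : (Fin n → ℝ) → ℝ} (hu : ContDiff ℝ ∞ u)
    (y : Fin n → ℝ) : ContDiff ℝ ∞ fun s => u (Function.update y p s) :=
  hu.comp (contDiff_update ∞ y p)

section
variable {f : (Fin 2 → ℝ) → ℝ} {δ : Eps → ℝ → ℝ} {x : Eps → (Fin 3 → ℝ) → (Fin 2 → ℝ)}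
  {v : Eps → (Fin 4 → ℝ) → ℝ}

/-- The net of the component `xⁱ`. -/
def xNet (x : Eps → (Fin 3 → ℝ) → (Fin 2 → ℝ)) (i : Fin 2) : Net 3 := fun ε y => x ε y i

theorem IsAsymptoticSolution.smooth_xNet (hxv : IsAsymptoticSolution f δ x v) (i : Fin 2) :
    (xNet x i).Smooth := fun ε => contDiff_pi.1 (hxv.smooth_x ε) i

theorem IsAsymptoticSolution.eventually_isGeodesic (hxv : IsAsymptoticSolution f δ x v) (R : ℝ) :
    ∀ᶠ ε in atBot, ∀ y : Fin 3 → ℝ, ∀ V : ℝ, ‖y‖ ≤ R → |V| ≤ R →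
      IsGeodesic f (δ ε) ![y 0, y 1] V (fun u => x ε (Function.update y 2 u))
        (fun u => v ε ![y 0, y 1, V, u]) := by
  obtain ⟨ε₀, h⟩ := hxv.solves (Metric.closedBall 0 R ×ˢ Metric.closedBall 0 R)
    ((isCompact_closedBall _ _).prod (isCompact_closedBall _ _))
  refine eventually_atBot.2 ⟨ε₀, fun ε hε y V hy hV => ?_⟩
  have h1 := h ε hε (![y 0, y 1], V) ⟨mem_closedBall_zero_iff.2
    ((pi_norm_le_iff_of_nonneg ((norm_nonneg y).trans hy)).2 fun i => ?_),
    mem_closedBall_zero_iff.2 hV⟩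
  · have h2 : ∀ u, Function.update y 2 u = ![y 0, y 1, u] := by
      intro u
      funext j
      fin_cases j <;> simp
    simp only [h2]
    exact h1
  · fin_cases i
    · exact (norm_le_pi_norm y 0).trans hy
    · exact (norm_le_pi_norm y 1).trans hy

theorem IsStrictDelta.eventually_eq_zero (hδ : IsStrictDelta δ) :
    ∀ᶠ ε in atBot, ∀ u < -1 / 2, δ ε u = 0 ∧ deriv (δ ε) u = 0 := by
  filter_upwards [eventually_lt_of_pos (by norm_num : (0 : ℝ) < 1 / 2)] with ε hε u hu
  have h : ∀ s < -1 / 2, δ ε s = 0 := fun s hs =>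
    image_eq_zero_of_notMem_tsupport fun h => by linarith [(hδ.supp ε h).1]
  refine ⟨h u hu, ?_⟩
  have h1 : δ ε =ᶠ[𝓝 u] fun _ => 0 := by
    filter_upwards [Iio_mem_nhds hu] with s hs using h s hs
  rw [h1.deriv_eq, deriv_const]

theorem IsAsymptoticSolution.evEq_xNet (hxv : IsAsymptoticSolution f δ x v) (i : Fin 2) :
    EvEqOn Set.univ (pd 2 (pd 2 (xNet x i)))
      (Net.comp (fun z => 1 / 2 * partialDeriv i f z) (xNet x) * timeNet 2 δ) := by
  intro R
  filter_upwards [hxv.eventually_isGeodesic R] with ε hε y _ hy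
  -- The equation for `x` does not involve `V`, so any admissible value serves.
  have h := (hε y 0 hy (by simpa using (norm_nonneg y).trans hy)).eq_x i (y 2)
  have hs := hxv.smooth_xNet i
  rw [show (fun r => x ε (Function.update y 2 r) i) = fun r => xNet x i ε (Function.update y 2 r)
    from rfl, deriv_comp_update 2 (hs ε), deriv_comp_update 2 (partialDeriv_contDiff 2 (hs ε))] at h
  simp only [Function.update_eq_self] at h
  exact h

theorem IsAsymptoticSolution.init_xNet (hδ : IsStrictDelta δ)
    (hxv : IsAsymptoticSolution f δ x v) (i : Fin 2) :
    EvEqOn {y | y 2 < -1 / 2} (xNet x i) (coordNet i.castSucc) := by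
  intro R
  filter_upwards [hxv.eventually_isGeodesic R, hδ.eventually_eq_zero] with ε hε hz y hy hyR
  have h := hε y 0 hyR (by simpa using (norm_nonneg y).trans hyR)
  have h1 := eq_of_deriv_deriv_eq_zero (contDiff_comp_update 2 (hxv.smooth_xNet i ε) y)
    (by norm_num : (-1 : ℝ) < -1 / 2) (h.init_x' i)
    (fun u hu => (h.eq_x i u).trans (by rw [(hz u hu).1, mul_zero])) hy
  rw [Function.update_eq_self] at h1
  rw [h1]
  have h2 := congrFun h.init_x i
  refine h2.trans ?_
  fin_cases i <;> rfl

/-! ### Bounds for `x` and its derivatives -/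

theorem IsAsymptoticSolution.growth_xNet (hf : ContDiff ℝ ∞ f) (hδ : IsStrictDelta δ)
    (hxv : IsAsymptoticSolution f δ x v) (i : Fin 2) :
    Growth ⊥ (xNet x i) ∧ Growth ⊥ (pd 2 (xNet x i)) :=
  growth_of_nonlinear_system hδ
    (fun i => (contDiff_const.mul (partialDeriv_contDiff i hf)).continuous)
    (fun i => (Fin.castSucc_lt_last i).ne) hxv.smooth_xNet hxv.evEq_xNet (hxv.init_xNet hδ) i

/-- The first derivatives of `x` solve a linear system whose coefficients are functions of `x`.
Control of `x` to order `k` thus gives control of the coefficients, hence of the first derivatives,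
to order `k`. The initial position is not constant, but its first derivatives are, as the linear
theory requires. -/
theorem IsAsymptoticSolution.derivGrowth_xNet (hf : ContDiff ℝ ∞ f) (hδ : IsStrictDelta δ)
    (hxv : IsAsymptoticSolution f δ x v) {S : AddSubmonoid ℕ} {J : Set (Fin 3)}
    (hJ : ∀ j ∈ J, ∀ k, DerivGrowth S J k (pd j (timeNet 2 δ))) (k : ℕ) :
    ∀ i, DerivGrowth S J k (xNet x i) ∧ DerivGrowth S J k (pd 2 (xNet x i)) := by
  have hb := hxv.growth_xNet hf hδ
  have hs := hxv.smooth_xNet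
  have hF : ∀ i, ContDiff ℝ ∞ fun z => 1 / 2 * partialDeriv i f z :=
    fun i => contDiff_const.mul (partialDeriv_contDiff i hf)
  have hF' : ∀ i l, ContDiff ℝ ∞ (partialDeriv l fun z => 1 / 2 * partialDeriv i f z) :=
    fun i l => partialDeriv_contDiff l (hF i)
  induction k with
  | zero => exact fun i => ⟨(hb i).1.mono bot_le, (hb i).2.mono bot_le⟩
  | succ k ih =>
    have next : ∀ j ∈ J, ∀ i, DerivGrowth S J k (pd j (xNet x i)) ∧
        DerivGrowth S J k (pd 2 (pd j (xNet x i))) := by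
      intro j hj
      refine derivGrowth_of_linear_system hδ hJ
        (a := fun i l => Net.comp (partialDeriv l fun z => 1 / 2 * partialDeriv i f z) (xNet x))
        (r := fun _ => constNet 3 0)
        (h := fun i => Net.comp (fun z => 1 / 2 * partialDeriv i f z) (xNet x) *
          pd j (timeNet 2 δ))
        (c := fun i => if i.castSucc = j then 1 else 0)
        (fun i l => growth_comp _ (hF' i l) fun i => (hb i).1) k
        (fun i l => derivGrowth_comp (hF' i l) (fun i => (hb i).1) fun i => (ih i).1)
        (fun i => derivGrowth_constNet 0) (fun i => ?_) (fun i => (hs i).pd j) (fun i => ?_)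
        (fun i => ?_)
      · exact (derivGrowth_comp (hF i) (fun i => (hb i).1) fun i => (ih i).1).mul (hJ j hj k)
      · have h1 := (hxv.evEq_xNet i).pd isOpen_univ j
        rw [pd_comm j 2 ((hs i).pd 2), pd_comm j 2 (hs i),
          pd_mul j (smooth_comp (hF i) hs) (hδ.smooth_timeNet 2), pd_comp j (hF i) hs,
          Finset.sum_mul] at h1
        rwa [constNet_zero, zero_mul, add_zero]
      · have h1 := (hxv.init_xNet hδ i).pd (isOpen_early 2) j
        rwa [pd_coordNet] at h1
    intro i
    refine ⟨⟨(hb i).1.mono bot_le, fun j hj => (next j hj i).1⟩,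
      ⟨(hb i).2.mono bot_le, fun j hj => ?_⟩⟩
    rw [pd_comm j 2 (hs i)]
    exact (next j hj i).2

/-! ### Equation and bounds for `v` -/

/-- The component `xⁱ` as a function of `(X, V, U)`. -/
def xLift (x : Eps → (Fin 3 → ℝ) → (Fin 2 → ℝ)) (i : Fin 2) : Net 4 :=
  (xNet x i).reindex ![0, 1, 3]

theorem pd_xLift (hxv : IsAsymptoticSolution f δ x v) (i : Fin 2) :
    pd 3 (xLift x i) = (pd 2 (xNet x i)).reindex ![0, 1, 3] :=
  pd_reindex_of_injective (σ := ![0, 1, 3]) 2 (by decide) (hxv.smooth_xNet i)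

/-- The net `v - V`. -/
def vShift (v : Net 4) : Net 4 := v + constNet 4 (-1) * coordNet 2

theorem smooth_vShift (hxv : IsAsymptoticSolution f δ x v) : (vShift v).Smooth :=
  Net.Smooth.add hxv.smooth_v ((smooth_constNet _).mul (growth_coordNet ⊥ 2).1)

theorem pd_vShift (hxv : IsAsymptoticSolution f δ x v) : pd 3 (vShift v) = pd 3 v := by
  rw [vShift, pd_add 3 hxv.smooth_v ((smooth_constNet _).mul (growth_coordNet ⊥ 2).1),
    pd_mul 3 (smooth_constNet _) (growth_coordNet ⊥ 2).1, pd_constNet, pd_coordNet]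
  simp [constNet_zero]

/-- The regular part `∑ᵢ ∂ᵢf(x) ẋⁱ` of the force on `v`. -/
noncomputable def vForce (f : (Fin 2 → ℝ) → ℝ) (x : Eps → (Fin 3 → ℝ) → (Fin 2 → ℝ)) : Net 4 :=
  ∑ i, Net.comp (partialDeriv i f) (xLift x) * pd 3 (xLift x i)

theorem smooth_xLift (hxv : IsAsymptoticSolution f δ x v) (i : Fin 2) : (xLift x i).Smooth :=
  (hxv.smooth_xNet i).reindex _

theorem eventually_isGeodesic_lift (hxv : IsAsymptoticSolution f δ x v) (R : ℝ) :
    ∀ᶠ ε in atBot, ∀ y : Fin 4 → ℝ, ‖y‖ ≤ R →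
      IsGeodesic f (δ ε) ![y 0, y 1] (y 2)
        (fun u i => xLift x i ε (Function.update y 3 u))
        (fun u => v ε (Function.update y 3 u)) := by
  filter_upwards [hxv.eventually_isGeodesic R] with ε hε y hy
  have h1 := hε ![y 0, y 1, y 3] (y 2)
    ((pi_norm_le_iff_of_nonneg ((norm_nonneg y).trans hy)).2 fun i => by
      fin_cases i
      · exact (norm_le_pi_norm y 0).trans hy
      · exact (norm_le_pi_norm y 1).trans hy
      · exact (norm_le_pi_norm y 3).trans hy) ((norm_le_pi_norm y 2).trans hy)
  have h2 : ∀ u, Function.update ![y 0, y 1, y 3] 2 u =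
      fun l => Function.update y 3 u ((![0, 1, 3] : Fin 3 → Fin 4) l) := by
    intro u
    funext l
    fin_cases l <;> simp
  have h3 : ∀ u, Function.update y 3 u = ![y 0, y 1, y 2, u] := by
    intro u
    funext l
    fin_cases l <;> simp
  simp only [h2, h3] at h1 ⊢
  exact h1

/-- By the product and chain rules, `d/dU (f(x) δ)` accounts for the term with `δ̇` and for one of
the two copies of `Σ ∂ᵢf(x) ẋⁱ δ`; the other copy remains. -/
theorem evEq_vShift (hf : ContDiff ℝ ∞ f) (hδ : IsStrictDelta δ)
    (hxv : IsAsymptoticSolution f δ x v) :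
    EvEqOn Set.univ (pd 3 (pd 3 (vShift v)))
      (pd 3 (Net.comp f (xLift x) * timeNet 3 δ) + vForce f x * timeNet 3 δ) := by
  have hX := smooth_xLift hxv
  rw [pd_vShift hxv, pd_mul 3 (smooth_comp hf hX) (hδ.smooth_timeNet 3), pd_comp 3 hf hX]
  intro R
  filter_upwards [eventually_isGeodesic_lift hxv R] with ε hε y _ hy
  have h := (hε y hy).eq_v (y 3)
  have hd : pd 3 (timeNet 3 δ) ε y = deriv (δ ε) (y 3) := by
    have h1 := hasDerivAt_comp_update 3 ((hδ.smooth_timeNet 3).differentiable ε) y (y 3)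
    simp only [timeNet, Function.update_self, Function.update_eq_self] at h1
    exact h1.deriv.symm
  rw [deriv_comp_update 3 (hxv.smooth_v ε), 
    deriv_comp_update 3 (partialDeriv_contDiff 3 (hxv.smooth_v ε))] at h
  simp only [deriv_comp_update 3 (hX _ ε), Function.update_eq_self] at h
  refine h.trans ?_
  simp only [vForce, Pi.add_apply, Pi.mul_apply, hd, Fin.sum_univ_two]
  simp only [Net.comp, timeNet, pd]
  ring

/-- Subtracting `V` makes the initial value constant, the form which the linear theory expects. -/
theorem init_vShift (hδ : IsStrictDelta δ) (hxv : IsAsymptoticSolution f δ x v) :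
    EvEqOn {y | y 3 < -1 / 2} (vShift v) (constNet 4 0) := by
  intro R
  filter_upwards [eventually_isGeodesic_lift hxv R, hδ.eventually_eq_zero] with ε hε hz y hy hyR
  have h := hε y hyR
  have h1 := eq_of_deriv_deriv_eq_zero (contDiff_comp_update 3 (hxv.smooth_v ε) y)
    (by norm_num : (-1 : ℝ) < -1 / 2) h.init_v'
    (fun u hu => (h.eq_v u).trans (by simp [(hz u hu).1, (hz u hu).2])) hy
  rw [Function.update_eq_self, h.init_v] at h1
  simp [vShift, constNet, coordNet, h1]

theorem derivGrowth_v (hf : ContDiff ℝ ∞ f) (hδ : IsStrictDelta δ)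
    (hxv : IsAsymptoticSolution f δ x v) (k : ℕ) : DerivGrowth ⊤ Set.univ k v := by
  have hD : ∀ k, DerivGrowth ⊤ Set.univ k (timeNet (3 : Fin 4) δ) :=
    hδ.derivGrowth_timeNet 3 Set.univ
  have hx := fun k i => hxv.derivGrowth_xNet hf hδ (S := ⊤) (J := Set.univ)
    (fun j _ k => (hδ.derivGrowth_timeNet 2 Set.univ (k + 1)).2 j trivial) k i
  have hX : ∀ k i, DerivGrowth ⊤ Set.univ k (xLift x i) := fun k i => (hx k i).1.reindex _
  have hX' : ∀ k i, DerivGrowth ⊤ Set.univ k (pd 3 (xLift x i)) := fun k i =>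
    (hX (k + 1) i).2 3 trivial
  have hXb : ∀ i, Growth ⊥ (xLift x i) := fun i => (hxv.growth_xNet hf hδ i).1.reindex _
  have h1 := (derivGrowth_of_linear_system (ι := Unit) (p := 3) hδ
    (fun j _ k => (hδ.derivGrowth_timeNet 3 Set.univ (k + 1)).2 j trivial)
    (a := fun _ _ => constNet 4 0) (fun _ _ => growth_constNet _ 0) k
    (r := fun _ => constNet 4 0)
    (h := fun _ => pd 3 (Net.comp f (xLift x) * timeNet 3 δ) + vForce f x * timeNet 3 δ)
    (z := fun _ => vShift v) (c := fun _ => 0)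
    (fun _ _ => derivGrowth_constNet 0) (fun _ => derivGrowth_constNet 0) (fun _ => ?_)
    (fun _ => smooth_vShift hxv) (fun _ => ?_) (fun _ => init_vShift hδ hxv) ()).1
  · have h2 : v = vShift v + coordNet 2 := by
      funext ε y
      simp [vShift, constNet]
    rw [h2]
    exact h1.add (derivGrowth_coordNet _ _ _ 2)
  · have h2 : DerivGrowth ⊤ Set.univ (k + 1) (Net.comp f (xLift x) * timeNet 3 δ) :=
      (derivGrowth_comp hf hXb (hX _)).mul (hD _)
    refine DerivGrowth.add (h2.2 3 trivial) (DerivGrowth.mul ?_ (hD k))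
    exact DerivGrowth.sum fun i =>
        (derivGrowth_comp (partialDeriv_contDiff i hf) hXb (hX _)).mul (hX' _ i)
  · simpa [constNet_zero] using evEq_vShift hf hδ hxv

/-- The linear theory only gives moderateness here, since `δ̇` is not uniformly bounded. With `P =
f(x) δ`, the difference `v̇ - P` has derivative at most `Q |δ|`, so it is bounded by `Q C`; then
`|v̇| ≤ M |δ| + Q C` is integrated once more. -/
theorem growth_v (hf : ContDiff ℝ ∞ f) (hδ : IsStrictDelta δ)
    (hxv : IsAsymptoticSolution f δ x v) : Growth ⊥ v := by
  have hXb : ∀ i, Growth ⊥ (xLift x i) := fun i => (hxv.growth_xNet hf hδ i).1.reindex _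
  have hXb' : ∀ i, Growth ⊥ (pd 3 (xLift x i)) := fun i => by
    rw [pd_xLift hxv]
    exact (hxv.growth_xNet hf hδ i).2.reindex _
  have hfb : Growth ⊥ (Net.comp f (xLift x)) := growth_comp _ hf hXb
  -- `DerivGrowth` of order 0 is `Growth` by definition.
  have hFb : Growth ⊥ (vForce f x) := DerivGrowth.sum (J := ∅) (k := 0) fun i =>
    Growth.mul (growth_comp _ (partialDeriv_contDiff i hf) hXb) (hXb' i)
  have hws := smooth_vShift hxv
  suffices H : Growth ⊥ (vShift v) by
    have h2 : v = vShift v + coordNet 2 := by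
      funext ε y
      simp [vShift, constNet]
    rw [h2]
    exact H.add (growth_coordNet _ 2)
  refine ⟨hws, fun R₀ => ?_⟩
  obtain ⟨R, hR₀, hR1⟩ : ∃ R, R₀ ≤ R ∧ 1 ≤ R := ⟨max R₀ 1, le_max_left _ _, le_max_right _ _⟩
  obtain ⟨C, hC0, hpulse⟩ := hδ.exists_isPulse
  obtain ⟨M, hM0, hM⟩ := Growth.uniform_bot (u := fun _ : Unit => Net.comp f (xLift x))
    (fun _ => hfb) R
  obtain ⟨Q, hQ0, hQ⟩ := Growth.uniform_bot (u := fun _ : Unit => vForce f x) (fun _ => hFb) R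
  refine ⟨0, zero_mem _, M * C + Q * C * (R + 1), ?_⟩
  filter_upwards [hpulse, hM, hQ, evEq_vShift hf hδ hxv R, init_vShift hδ hxv R,
    (init_vShift hδ hxv).pd (isOpen_early 3) 3 R, hδ.eventually_eq_zero]
    with ε hε hMε hQε heq hi hi' hz y hy₀
  have hy := hy₀.trans hR₀
  rw [pow_zero, mul_one]
  rcases lt_or_ge (y 3) (-1 / 2) with hyp | hyp
  · rw [hi y hyp hy, constNet, abs_zero]
    positivity
  have hpR : ‖y 3‖ ≤ R := (norm_le_pi_norm y 3).trans hy
  rw [Real.norm_eq_abs, abs_le] at hpR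
  have hm1 : ‖Function.update y 3 (-1)‖ ≤ R := norm_update_le 3 hy (by simpa using hR1)
  have hm2 : Function.update y 3 (-1) 3 < -1 / 2 := by norm_num
  have hw : ∀ s ∈ Set.Icc (-1) R, ‖Function.update y 3 s‖ ≤ R := fun s hs =>
    norm_update_le 3 hy (abs_le.2 ⟨by linarith [hs.1], hs.2⟩)
  set P : Net 4 := Net.comp f (xLift x) * timeNet 3 δ with hP
  have hPs : P.Smooth := hfb.1.mul (hδ.smooth_timeNet 3)
  have hδs : ∀ s, timeNet 3 δ ε (Function.update y 3 s) = δ ε s := fun s => by simp [timeNet]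
  have hq : ∀ s, HasDerivAt (fun s => pd 3 (vShift v) ε (Function.update y 3 s) -
      P ε (Function.update y 3 s)) (pd 3 (pd 3 (vShift v)) ε (Function.update y 3 s) -
      pd 3 P ε (Function.update y 3 s)) s := fun s =>
    (hasDerivAt_comp_update 3 ((hws.pd 3).differentiable ε) y s).sub
      (hasDerivAt_comp_update 3 (hPs.differentiable ε) y s)
  have hqb : ∀ s ∈ Set.Icc (-1) R, ‖pd 3 (vShift v) ε (Function.update y 3 s) -
      P ε (Function.update y 3 s)‖ ≤ Q * C := by
    intro s hs
    have h1 := norm_sub_le_of_norm_deriv_le (A := Q) (B := 0) hq hε.continuous (a := -1) (b := R)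
      (fun r hr => by
        rw [heq _ trivial (hw r ⟨hr.1, hr.2.le⟩), Pi.add_apply, Pi.add_apply, add_sub_cancel_left,
          Pi.mul_apply, Pi.mul_apply, hδs, norm_mul, add_zero, Real.norm_eq_abs (δ ε r)]
        exact mul_le_mul_of_nonneg_right (hQε () _ (hw r ⟨hr.1, hr.2.le⟩)) (abs_nonneg _)) hs
    have h2 : P ε (Function.update y 3 (-1)) = 0 := by
      rw [hP, Pi.mul_apply, Pi.mul_apply, hδs, (hz (-1) (by norm_num)).1, mul_zero]
    rw [hi' _ hm2 hm1, pd_constNet, h2] at h1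
    simp only [constNet, sub_zero, zero_mul, add_zero] at h1
    exact h1.trans (mul_le_mul_of_nonneg_left (hε.intervalIntegral_le hs.1) hQ0)
  have hyp' : y 3 ∈ Set.Icc (-1) R := ⟨by linarith, hpR.2⟩
  have h1 := norm_sub_le_of_norm_deriv_le (A := M) (B := Q * C)
    (hasDerivAt_comp_update 3 (hws.differentiable ε) y) hε.continuous (a := -1) (b := R)
    (fun s hs => by
      have hs' : s ∈ Set.Icc (-1) R := ⟨hs.1, hs.2.le⟩
      have h2 : ‖P ε (Function.update y 3 s)‖ ≤ M * |δ ε s| := by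
        rw [hP, Pi.mul_apply, Pi.mul_apply, hδs, norm_mul, Real.norm_eq_abs (δ ε s)]
        exact mul_le_mul_of_nonneg_right (hMε () _ (hw s hs')) (abs_nonneg _)
      calc ‖partialDeriv 3 (vShift v ε) (Function.update y 3 s)‖
          = ‖P ε (Function.update y 3 s) + (pd 3 (vShift v) ε (Function.update y 3 s) -
              P ε (Function.update y 3 s))‖ := by rw [add_sub_cancel]; rfl
        _ ≤ _ := (norm_add_le _ _).trans (add_le_add h2 (hqb s hs'))) hyp'
  rw [hi _ hm2 hm1] at h1
  simp only [Function.update_eq_self, constNet, sub_zero] at h1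
  refine h1.trans ?_
  have h3 := hε.intervalIntegral_le hyp'.1
  have h4 : y 3 - -1 ≤ R + 1 := by linarith [hpR.2]
  gcongr

end

end PPWave

open PPWave

/-! ### The transformation and the `X`-derivatives -/

theorem proposition5p1
    (f : (Fin 2 → ℝ) → ℝ) (hf : ContDiff ℝ ∞ f)
    (δ : Eps → ℝ → ℝ) (hδ : IsStrictDelta δ)
    (x : Eps → (Fin 3 → ℝ) → (Fin 2 → ℝ)) (v : Eps → (Fin 4 → ℝ) → ℝ)
    (hxv : IsAsymptoticSolution f δ x v) :
    transform x v ∈ cBoundedNets (⊤ : Opens (Fin 4 → ℝ)) (⊤ : Opens (Fin 4 → ℝ)) ∧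
    (∃ h : ∀ j : Fin 4,
        (fun ε y => transform x v ε y j) ∈ moderate (⊤ : Opens (Fin 4 → ℝ)),
      genClass ⊤ (transform x v) h ∈
        cBoundedGen (⊤ : Opens (Fin 4 → ℝ)) (⊤ : Opens (Fin 4 → ℝ))) ∧
    (∀ (α : Fin 2 → ℕ) (i : Fin 2),
      (fun ε y (_ : Fin 1) => multiDeriv ![α 0, α 1, 0] (fun z => x ε z i) y) ∈
        cBoundedNets (⊤ : Opens (Fin 3 → ℝ)) (⊤ : Opens (Fin 1 → ℝ)) ∧
      (fun ε y (_ : Fin 1) => multiDeriv ![α 0, α 1, 1] (fun z => x ε z i) y) ∈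
        cBoundedNets (⊤ : Opens (Fin 3 → ℝ)) (⊤ : Opens (Fin 1 → ℝ))) := by
  have hmod := fun i k => (hxv.derivGrowth_xNet hf hδ (S := ⊤) (J := Set.univ)
    (fun j _ k => (hδ.derivGrowth_timeNet 2 Set.univ (k + 1)).2 j trivial) k i).1
  -- Excluding the time direction 2 makes the derivatives of the delta net vanish, so uniform bounds
  -- survive at every order.
  have hbdd := fun i k => hxv.derivGrowth_xNet hf hδ (S := ⊥) (J := {2}ᶜ)
    (fun j hj k => by rw [hδ.pd_timeNet hj]; exact derivGrowth_constNet 0) k i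
  have hx : ∀ i, (fun ε (y : Fin 4 → ℝ) => x ε ![y 1, y 2, y 0] i) =
      (xNet x i).reindex ![1, 2, 0] := by
    intro i
    funext ε y
    refine congrArg (fun w => x ε w i) ?_
    funext l
    fin_cases l <;> rfl
  have hv : (fun ε (y : Fin 4 → ℝ) => v ε ![y 1, y 2, y 3, y 0]) =
      Net.reindex ![1, 2, 3, 0] v := by
    funext ε y
    refine congrArg (v ε) ?_
    funext l
    fin_cases l <;> rfl
  have hb : ∀ j, Growth ⊥ (fun ε y => transform x v ε y j) := by
    intro j
    fin_cases j
    · exact growth_coordNet _ 0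
    · exact (hx 0).symm ▸ (hbdd 0 0).1.growth.reindex _
    · exact (hx 1).symm ▸ (hbdd 1 0).1.growth.reindex _
    · exact hv.symm ▸ (growth_v hf hδ hxv).reindex _
  have hm : ∀ j k, DerivGrowth ⊤ Set.univ k (fun ε y => transform x v ε y j) := by
    intro j k
    fin_cases j
    · exact derivGrowth_coordNet _ _ _ 0
    · exact (hx 0).symm ▸ (hmod 0 k).reindex _
    · exact (hx 1).symm ▸ (hmod 1 k).reindex _
    · exact hv.symm ▸ (derivGrowth_v hf hδ hxv k).reindex _
  have hmem := mem_cBoundedNets_of_growth hb hm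
  refine ⟨hmem, ⟨fun j => mem_moderate_of_derivGrowth (hm j), _, hmem, _, rfl⟩, fun α i => ?_⟩
  have hα : ∀ j ∉ ({2}ᶜ : Set (Fin 3)), (![α 0, α 1, 0] : Fin 3 → ℕ) j = 0 := by
    intro j hj
    obtain rfl : j = 2 := by simpa using hj
    rfl
  refine ⟨mem_cBoundedNets_of_growth (fun _ => ?_) (fun _ => ?_),
    mem_cBoundedNets_of_growth (fun _ => ?_) (fun _ => ?_)⟩
  · exact (derivGrowth_multiDeriv (fun k => (hbdd i k).1) hα 0).growth
  · exact derivGrowth_multiDeriv (hmod i) (by simp)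
  -- In `multiDeriv` the last coordinate is differentiated first, so the multi-index `![α 0, α 1,
  -- 1]` on `x` unfolds to `![α 0, α 1, 0]` on `pd 2 (xNet x i)`.
  · exact (derivGrowth_multiDeriv (fun k => (hbdd i k).2) hα 0).growth
  · exact derivGrowth_multiDeriv (hmod i) (by simp)
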